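/- Let $d\ge 1$ and let $\mathcal M^d$ be the set of probability vectors on the $2d$ nearest neighbours $\pm e_1,\dots,\pm e_d$ of the origin of $\mathbb Z^d$. Let $\nu$ be a probability measure on $\mathcal M^d$ and let $P=\nu^{\mathbb Z^d}$ be the law of an i.i.d. environment $\omega=(\omega(z,e))_{z,e}$. Assume that $P$-almost surely $\omega$ is balanced ($\omega(z,e)=\omega(z,-e)$ for all $z,e$) and genuinely $d$-dimensional (for every $e$ there is $z$ with $\omega(z,e)>0$). Let $P^x_\omega$ be the law of the Markov chain $(X_n)$ on $\mathbb Z^d$ with $X_0=x$ that jumps from $z$ to $z+e$ with probability $\omega(z,e)$, and write $(\tau_{-z}\omega)(y)=\omega(z+y)$. The environment viewed from the particle is the Markov chain on environments that jumps from $\omega$ to $\tau_{-e}\omega$ with probability $\omega(0,e)$. Below, $Q$ is called admissible if it is a probability measure that is invariant and ergodic for this chain and satisfies $Q\ll P$; put $\operatorname{supp}_\omega Q=\{z\in\mathbb Z^d:\frac{dQ}{dP}(\tau_{-z}\omega)>0\}$. A nonempty set $A\subseteq\mathbb Z^d$ is a sink for $\omega$ if $P^x_\omega(\exists n: X_n=y)>0$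 for all $x,y\in A$, and $P^x_\omega(\exists n: X_n=y)=0$ for all $x\in A$, $y\notin A$. The upper and lower densities of $A$ are the limsup and liminf, as $N\to\infty$, of $|A\cap[-N,N]^d|/|[-N,N]^d|$. Let $\Delta_N=[0,N)^d\cap\mathbb Z^d$. The reflected walk on $\Delta_N$ moves as the walk in $\omega$, except that it stays put whenever that walk would leave $\Delta_N$. Call $\Phi>0$ a support constant for $P$ if, $P$-almost surely, for all large enough $N$, every stationary probability measure of the reflected walk on $\Delta_N$ has a support of at least $\Phi|\Delta_N|$ sites. Then: 1. There is $\kappa>0$, depending only on $P$, such that for every admissible $Q$, for $P$-almost every $\omega$, $\operatorname{supp}_\omega Q$ contains a sink of upper density at least $\kappa$. 2. A support constant exists, and for every support constant $\Phi$, for $P$-almost every $\omega$, every sink has lower density at least $\Phi/2^d$. 3. For every admissible $Q$, for $P$-almost every $\omega$, only finitely many sinks are contained in $\operatorname{supp}_\omega Q$, every point of $\operatorname{supp}_\omega Q$ belongs to a sink, and $\operatorname{supp}_\omega Q$ is the union of the sinks it contains. -/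

import Mathlib

open MeasureTheory ProbabilityTheory Filter
open scoped ENNReal

namespace BalancedRWRE

/-- The lattice `ℤ^d`. -/
abbrev Site (d : ℕ) : Type := Fin d → ℤ

/-- The `2d` nearest neighbours of the origin: `(i, true)` stands for `e_i` and
`(i, false)` for `-e_i`. -/
abbrev Dir (d : ℕ) : Type := Fin d × Bool

/-- The lattice vector `± e_i` of a direction. -/
def Dir.vec {d : ℕ} (e : Dir d) : Site d := Pi.single e.1 (if e.2 then 1 else -1)

/-- The direction `-e`. -/
def Dir.opp {d : ℕ} (e : Dir d) : Dir d := (e.1, !e.2)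

theorem Dir.vec_opp {d : ℕ} (e : Dir d) : e.opp.vec = -e.vec := by
  obtain ⟨i, b⟩ := e
  cases b <;> simp [Dir.vec, Dir.opp, Pi.single_neg]

/-- The space of all probability vectors on the nearest neighbours of the origin. -/
abbrev LocalLaw (d : ℕ) : Type := stdSimplex ℝ (Dir d)

/-- Environments: a probability vector on the neighbours of the origin at each site.
The measurable structure is the product one. -/
abbrev Env (d : ℕ) : Type := Site d → LocalLaw d

/-- The transition probability `ω(z, e)`. -/
def Env.prob {d : ℕ} (ω : Env d) (z : Site d) (e : Dir d) : ℝ := (ω z).1 e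

/-- The law of an i.i.d. environment with single-site distribution `ν`. -/
noncomputable def envLaw {d : ℕ} (ν : Measure (LocalLaw d)) : Measure (Env d) :=
  Measure.infinitePi (fun _ : Site d => ν)

/-- The environment seen from the site `z`, that is `τ_{-z} ω`: `(τ_{-z} ω)(y) = ω(z + y)`. -/
def Env.from {d : ℕ} (z : Site d) (ω : Env d) : Env d := fun y => ω (z + y)

/-- `ω(z, e) = ω(z, -e)` for all sites `z` and all directions `e`. -/
def Balanced {d : ℕ} (ω : Env d) : Prop :=
  ∀ (z : Site d) (e : Dir d), ω.prob z e = ω.prob z e.opp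

/-- Every direction is used with positive probability at some site. -/
def GenuinelyDDimensional {d : ℕ} (ω : Env d) : Prop :=
  ∀ e : Dir d, ∃ z : Site d, 0 < ω.prob z e

section Kernels

variable {d : ℕ}

theorem Env.sum_ofReal_prob (ω : Env d) (z : Site d) :
    ∑ e, ENNReal.ofReal (ω.prob z e) = 1 := by
  have h0 : ∀ e ∈ Finset.univ, 0 ≤ ω.prob z e := fun e _ => (ω z).2.1 e
  rw [← ENNReal.ofReal_sum_of_nonneg h0]
  have h : ∑ e, ω.prob z e = 1 := (ω z).2.2
  rw [h, ENNReal.ofReal_one]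

/-- The law of the position `t z e`, where `e` is a direction chosen with
probability `ω(z, e)`. -/
noncomputable def jumpKernel (ω : Env d) (t : Site d → Dir d → Site d) :
    Kernel (Site d) (Site d) where
  toFun z := ∑ e, ENNReal.ofReal (ω.prob z e) • Measure.dirac (t z e)
  measurable' := measurable_of_countable _

instance (ω : Env d) (t : Site d → Dir d → Site d) : IsMarkovKernel (jumpKernel ω t) where
  isProbabilityMeasure z := ⟨by
    change (∑ e, ENNReal.ofReal (ω.prob z e) • Measure.dirac (t z e)) Set.univ = 1
    simp [Measure.finsetSum_apply, Env.sum_ofReal_prob]⟩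

/-- One step of the walk in `ω`: from `z` to `z + e` with probability `ω(z, e)`. -/
noncomputable def stepKernel (ω : Env d) : Kernel (Site d) (Site d) :=
  jumpKernel ω fun z e => z + e.vec

instance (ω : Env d) : IsMarkovKernel (stepKernel ω) :=
  inferInstanceAs (IsMarkovKernel (jumpKernel ω _))

/-- The quenched law `P_ω^x` on trajectories `(X_n)_{n ≥ 0}`: the Markov chain with
`X_0 = x` and one-step transition kernel `stepKernel ω`. -/
noncomputable def quenchedLaw (ω : Env d) (x : Site d) : Measure (ℕ → Site d) :=
  Kernel.trajMeasure (X := fun _ : ℕ => Site d) (Measure.dirac x)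
    (fun n => (stepKernel ω).comap
      (fun h : (i : Finset.Iic n) → Site d => h ⟨n, Finset.mem_Iic.2 le_rfl⟩)
      (measurable_pi_apply _))

/-- The cube `Δ_N = [0, N)^d`. -/
def cube (d N : ℕ) : Set (Site d) := {z | ∀ i, 0 ≤ z i ∧ z i < (N : ℤ)}

open Classical in
/-- One step of the walk in `ω` reflected at the boundary of `Δ_N`: when the walk wants to leave
the cube it stays put for that step. (Only used for starting points in the cube.) -/
noncomputable def reflectedKernel (ω : Env d) (N : ℕ) : Kernel (Site d) (Site d) :=
  jumpKernel ω fun z e => if z + e.vec ∈ cube d N then z + e.vec else z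

/-- `μ` is a stationary probability measure on `Δ_N` of the reflected walk in `ω`. -/
def IsReflectedStationary (ω : Env d) (N : ℕ) (μ : Measure (Site d)) : Prop :=
  IsProbabilityMeasure μ ∧ μ (cube d N)ᶜ = 0 ∧ (reflectedKernel ω N).Invariant μ

/-- For `P`-almost every `ω` and all large `N`, every stationary probability measure of the
reflected walk on `Δ_N` charges at least `Φ |Δ_N| = Φ N^d` sites. -/
def IsReflectedSupportBound (P : Measure (Env d)) (Φ : ℝ) : Prop :=
  ∀ᵐ ω ∂P, ∀ᶠ N : ℕ in atTop, ∀ μ : Measure (Site d), IsReflectedStationary ω N μ →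
    Φ * (N : ℝ) ^ d ≤ (({z : Site d | 0 < μ {z}} : Set (Site d)).ncard : ℝ)

theorem measurable_prob (z : Site d) (e : Dir d) : Measurable fun ω : Env d => ω.prob z e :=
  (measurable_pi_apply e).comp (measurable_subtype_coe.comp (measurable_pi_apply z))

theorem measurable_from (z : Site d) : Measurable (Env.from z) :=
  measurable_pi_lambda _ fun y => measurable_pi_apply (z + y)

/-- The environment viewed from the particle, `τ_{-X_n} ω`, as a Markov chain on environments:
from `ω` to `τ_{-e} ω` with probability `ω(0, e)`. -/
noncomputable def particleKernel (d : ℕ) : Kernel (Env d) (Env d) where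
  toFun ω := ∑ e : Dir d, ENNReal.ofReal (ω.prob 0 e) • Measure.dirac (Env.from e.vec ω)
  measurable' := by
    refine Measure.measurable_of_measurable_coe _ fun s hs => ?_
    simp only [Measure.finsetSum_apply, Measure.smul_apply, smul_eq_mul]
    refine Finset.measurable_fun_sum _ fun e _ => ?_
    refine ((measurable_prob 0 e).ennreal_ofReal).mul ?_
    exact (Measure.measurable_coe hs).comp (Measure.measurable_dirac.comp (measurable_from _))

/-- `Q` is a probability measure that is invariant for the environment viewed from the particle,
and the chain started from `Q` is ergodic: every measurable set `A` whose indicator is harmonic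
`Q`-almost surely has `Q`-measure `0` or `1`. -/
structure IsErgodicInvariant (Q : Measure (Env d)) : Prop where
  prob : IsProbabilityMeasure Q
  invariant : (particleKernel d).Invariant Q
  ergodic : ∀ A : Set (Env d), MeasurableSet A →
    (∀ᵐ ω ∂Q, particleKernel d ω A = A.indicator 1 ω) → Q A = 0 ∨ Q A = 1

/-- `supp_ω Q`, the set of sites `z` such that `dQ/dP > 0` at `τ_{-z} ω`. -/
def suppAt (P Q : Measure (Env d)) (ω : Env d) : Set (Site d) :=
  {z | 0 < Q.rnDeriv P (Env.from z ω)}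

/-- `y` is reachable from `x`: `P_ω^x(∃ n, X_n = y) > 0`. -/
def Reaches (ω : Env d) (x y : Site d) : Prop :=
  0 < quenchedLaw ω x {X | ∃ n, X n = y}

/-- A sink: a nonempty strongly connected set out of which no other site is reachable. -/
structure IsSink (ω : Env d) (A : Set (Site d)) : Prop where
  nonempty : A.Nonempty
  stronglyConnected : ∀ x ∈ A, ∀ y ∈ A, Reaches ω x y
  closed : ∀ x ∈ A, ∀ y ∉ A, ¬ Reaches ω x y

/-- The box `[-N, N]^d`. -/
noncomputable def box (d N : ℕ) : Finset (Site d) := Fintype.piFinset fun _ => Finset.Icc (-(N : ℤ)) (N : ℤ)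

/-- The proportion of sites of `[-N, N]^d` that belong to `A`. -/
noncomputable def boxDensity (A : Set (Site d)) (N : ℕ) : ℝ :=
  ((A ∩ (box d N : Set (Site d))).ncard : ℝ) / ((box d N).card : ℝ)

/-- Upper density of a subset of `ℤ^d`. -/
noncomputable def upperDensity (A : Set (Site d)) : ℝ := limsup (boxDensity A) atTop

/-- Lower density of a subset of `ℤ^d`. -/
noncomputable def lowerDensity (A : Set (Site d)) : ℝ := liminf (boxDensity A) atTop

end Kernels

end BalancedRWRE

/-! Everything rests on one deterministic-plus-random fact (`ae_eventually_card_ge`): almost surely,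
in every large cube, each nonempty set S that the reflected walk cannot leave occupies a fixed
fraction of the cube. It is an Alexandrov–Bakelman–Pucci argument carried out on S itself. For each
of order N^d slopes, a concave paraboloid peaking near the centre of the cube is maximised over S at
a contact point. Balance makes linear functions martingales in the interior, and near the faces
reflection pushes towards the peak. If the walk from a contact point z is likely to find a site with
active axis i within distance n, then some such site y in S has a value within O(n^2) of the
maximum. Since S contains both moves along i from y, the i-th slope at z is O(n^2) (`abs_slope_le`).
So each contact point serves boundedly many slopes in terms of its good scale, and counting slopes
bounds |S| from below (`card_slopes_le`, `IsReflClosed.card_ge`).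

The scales are controlled by randomness. To leave a box of radius n without meeting an active axis
the walk must see n distinct inactive sites, whose annealed cost is exponentially small in n
(`measure_bad_le`). Bad events at distant sites are independent, so Chebyshev and Borel–Cantelli
bound the average of the squared slope counts.

Supports of stationary measures are closed sets, and conversely every nonempty closed set carries a
stationary measure. Hence a support constant exists, and any support constant bounds the size of all
closed sets. A sink is closed for the walk, so its trace on a cube with a corner in the sink is
closed for the reflected walk; such a cube fills the fraction 2^{-d} of a centred box. This gives
the density bound, and disjointness of sinks then gives finiteness.

For an admissible Q, supp Q is closed for the walk. Its trace on a cube contains a strongly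
connected closed set of positive density, and away from the boundary of the cube such a set is
indistinguishable from a sink for k steps (`eventually_card_returns`). Stationarity and Fatou,
followed by k → ∞, show that the origin lies in a sink and in supp Q with positive probability
(`measure_inter_originInSink_pos`). Lying in a sink is preserved by the walk, so ergodicity raises
its Q-probability to one (`ae_mem_originInSink`), and every point of supp Q lies in a sink. -/

namespace BalancedRWRE

/-! ### Reachability as a property of the directed graph of possible steps -/

variable {d : ℕ}

/-- The directed graph of the possible steps of the walk in `ω`. -/
def Edge (ω : Env d) (x y : Site d) : Prop := ∃ e, 0 < ω.prob x e ∧ y = x + e.vec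

theorem prob_nonneg (ω : Env d) (z : Site d) (e : Dir d) : 0 ≤ ω.prob z e := (ω z).2.1 e

theorem sum_prob (ω : Env d) (z : Site d) : ∑ e, ω.prob z e = 1 := (ω z).2.2

theorem jumpKernel_apply (ω : Env d) (t : Site d → Dir d → Site d) (z : Site d)
    (s : Set (Site d)) :
    jumpKernel ω t z s = ∑ e, ENNReal.ofReal (ω.prob z e) * s.indicator 1 (t z e) := by
  change (∑ e, ENNReal.ofReal (ω.prob z e) • Measure.dirac (t z e)) s = _
  simp [Measure.finsetSum_apply]

theorem jumpKernel_singleton_pos (ω : Env d) (t : Site d → Dir d → Site d) (z y : Site d) :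
    0 < jumpKernel ω t z {y} ↔ ∃ e, 0 < ω.prob z e ∧ y = t z e := by
  rw [jumpKernel_apply, pos_iff_ne_zero, Ne, Finset.sum_eq_zero_iff]
  push Not
  constructor
  · rintro ⟨e, -, he⟩
    refine ⟨e, ?_, ?_⟩
    · by_contra h
      exact he (by rw [ENNReal.ofReal_of_nonpos (not_lt.1 h), zero_mul])
    · by_contra h
      exact he (by rw [Set.indicator_of_notMem (by simpa using Ne.symm h), mul_zero])
  · rintro ⟨e, he, rfl⟩
    exact ⟨e, Finset.mem_univ _, by simp [he]⟩

instance (ω : Env d) (x : Site d) : IsProbabilityMeasure (quenchedLaw ω x) := by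
  unfold quenchedLaw; infer_instance

/-- One step of the marginal laws of the walk. -/
theorem quenchedLaw_succ (ω : Env d) (x : Site d) (n : ℕ) (s : Set (Site d)) :
    quenchedLaw ω x {X | X (n + 1) ∈ s} = ∫⁻ X, stepKernel ω (X n) s ∂quenchedLaw ω x := by
  have hs : MeasurableSet s := MeasurableSet.of_discrete
  have h := Kernel.map_frestrictLe_trajMeasure_compProd_eq_map_trajMeasure
    (X := fun _ : ℕ => Site d) (μ₀ := Measure.dirac x)
    (κ := fun n => (stepKernel ω).comap
      (fun h : (i : Finset.Iic n) → Site d => h ⟨n, Finset.mem_Iic.2 le_rfl⟩)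
      (measurable_pi_apply _)) (a := n)
  have h2 := congrArg (fun m => m (Prod.snd ⁻¹' s)) h
  rw [Measure.map_apply (by fun_prop) (measurable_snd hs),
    Measure.compProd_apply (measurable_snd hs), lintegral_map ?_ (by fun_prop)] at h2
  · exact h2.symm
  · exact (measurable_of_countable fun z => stepKernel ω z s).comp (measurable_pi_apply _)

theorem quenchedLaw_zero (ω : Env d) (x : Site d) :
    ∀ᵐ X ∂quenchedLaw ω x, X 0 = x := by
  have h : quenchedLaw ω x = Kernel.traj (X := fun _ : ℕ => Site d)
      (fun n => (stepKernel ω).comap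
        (fun h : (i : Finset.Iic n) → Site d => h ⟨n, Finset.mem_Iic.2 le_rfl⟩)
        (measurable_pi_apply _)) 0
      ((MeasurableEquiv.piUnique (fun _ : Finset.Iic 0 => Site d)).symm x) := by
    unfold quenchedLaw Kernel.trajMeasure
    exact (congrArg (fun m => Measure.bind m _)
      (Measure.map_dirac' (MeasurableEquiv.measurable _) x)).trans
        (Measure.dirac_bind (Kernel.measurable _) _)
  have h2 := Kernel.traj_map_frestrictLe_apply (X := fun _ : ℕ => Site d)
      (κ := fun n => (stepKernel ω).comap
        (fun h : (i : Finset.Iic n) → Site d => h ⟨n, Finset.mem_Iic.2 le_rfl⟩)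
        (measurable_pi_apply _)) 0 0
      ((MeasurableEquiv.piUnique (fun _ : Finset.Iic 0 => Site d)).symm x)
  rw [← h, Kernel.partialTraj_self, Kernel.id_apply] at h2
  have h3 : ∀ᵐ Y ∂(quenchedLaw ω x).map (Preorder.frestrictLe (π := fun _ : ℕ => Site d) 0),
      Y ⟨0, Finset.mem_Iic.2 le_rfl⟩ = x := by
    rw [h2]
    have hm : Measurable fun Y : Finset.Iic 0 → Site d => Y ⟨0, Finset.mem_Iic.2 le_rfl⟩ :=
      measurable_pi_apply _
    exact (ae_dirac_iff (hm (MeasurableSet.singleton x))).2 rfl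
  exact ae_of_ae_map (by fun_prop) h3

theorem exists_path_of_pos (ω : Env d) (x y : Site d) (n : ℕ)
    (h : 0 < quenchedLaw ω x {X | X n = y}) : Relation.ReflTransGen (Edge ω) x y := by
  induction n generalizing y with
  | zero =>
    by_cases hxy : x = y
    · rw [hxy]
    · refine absurd ?_ h.ne'
      have := quenchedLaw_zero ω x
      rw [ae_iff] at this
      refine measure_mono_null (fun X (hX : X 0 = y) => ?_) this
      simpa [hX] using Ne.symm hxy
  | succ n ih =>
    have h1 := quenchedLaw_succ ω x n {y}
    simp only [Set.mem_singleton_iff] at h1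
    rw [h1] at h
    by_contra hc
    refine h.ne' ?_
    rw [lintegral_eq_zero_iff' (Measurable.aemeasurable (by
      exact (measurable_of_countable fun z => stepKernel ω z {y}).comp (measurable_pi_apply n)))]
    have : ∀ᵐ X ∂quenchedLaw ω x, ∀ z, 0 < stepKernel ω z {y} → X n ≠ z := by
      rw [ae_all_iff]
      intro z
      by_cases hz : 0 < stepKernel ω z {y}
      · simp only [hz, true_imp_iff]
        rw [ae_iff]
        simp only [not_not, ne_eq]
        by_contra h0
        obtain ⟨e, he⟩ := (jumpKernel_singleton_pos _ _ _ _).1 hz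
        exact hc ((ih z (pos_iff_ne_zero.2 h0)).tail ⟨e, he⟩)
      · simp [hz]
    filter_upwards [this] with X hX
    by_contra h0
    exact hX (X n) (pos_iff_ne_zero.2 h0) rfl

theorem pos_of_path (ω : Env d) (x y : Site d) (h : Relation.ReflTransGen (Edge ω) x y) :
    ∃ n, 0 < quenchedLaw ω x {X | X n = y} := by
  induction h with
  | refl =>
    refine ⟨0, ?_⟩
    have := (prob_compl_eq_zero_iff (μ := quenchedLaw ω x)
      (measurable_pi_apply 0 (MeasurableSet.singleton x))).1 (quenchedLaw_zero ω x)
    change 0 < quenchedLaw ω x ((fun X => X 0) ⁻¹' {x})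
    rw [this]; exact one_pos
  | @tail b c _ hbc ih =>
    obtain ⟨n, hn⟩ := ih
    refine ⟨n + 1, ?_⟩
    have h1 := quenchedLaw_succ ω x n {c}
    simp only [Set.mem_singleton_iff] at h1
    rw [h1]
    have hb : 0 < stepKernel ω b {c} := by
      obtain ⟨e, he⟩ := hbc
      exact (jumpKernel_singleton_pos _ _ _ _).2 ⟨e, he⟩
    calc 0 < stepKernel ω b {c} * quenchedLaw ω x {X | X n = b} := ENNReal.mul_pos hb.ne' hn.ne'
      _ = ∫⁻ X in {X | X n = b}, stepKernel ω b {c} ∂quenchedLaw ω x := by simp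
      _ = ∫⁻ X in {X | X n = b}, stepKernel ω (X n) {c} ∂quenchedLaw ω x := by
        have hm : Measurable fun X : ℕ → Site d => X n := measurable_pi_apply n
        refine setLIntegral_congr_fun (hm (MeasurableSet.singleton b)) ?_
        intro X (hX : X n = b)
        simp [hX]
      _ ≤ _ := setLIntegral_le_lintegral _ _

/-- There are countably many times and positions, so a hitting event of positive probability is
realised by a finite path of possible steps. From here on sinks are purely combinatorial. -/
theorem reaches_iff (ω : Env d) (x y : Site d) :
    Reaches ω x y ↔ Relation.ReflTransGen (Edge ω) x y := by
  constructor
  · intro h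
    have h' : 0 < quenchedLaw ω x (⋃ n, {X | X n = y}) := by
      rwa [← Set.ofPred_exists]
    by_contra hc
    refine h'.ne' (measure_iUnion_null fun n => ?_)
    by_contra h0
    exact hc (exists_path_of_pos ω x y n (pos_iff_ne_zero.2 h0))
  · intro h
    obtain ⟨n, hn⟩ := pos_of_path ω x y h
    exact hn.trans_le (measure_mono fun X hX => ⟨n, hX⟩)

/-! ### Geometry of the reflected walk -/

open Classical in
/-- The site reached from `x` when the walk reflected at the boundary of the cube wants to
move in direction `e`. -/
noncomputable def refl (N : ℕ) (x : Site d) (e : Dir d) : Site d :=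
  if x + e.vec ∈ cube d N then x + e.vec else x

/-- The distance of `x` from `z` in the supremum norm. -/
def rad (z x : Site d) : ℕ := Finset.univ.sup fun j => (x j - z j).natAbs

theorem rad_le_iff {z x : Site d} {n : ℕ} : rad z x ≤ n ↔ ∀ j, |x j - z j| ≤ (n : ℤ) := by
  simp only [rad, Finset.sup_le_iff, Finset.mem_univ, true_imp_iff]
  exact forall_congr' fun j => by rw [Int.abs_eq_natAbs]; omega

theorem rad_lt_iff {z x : Site d} {n : ℕ} (hn : 0 < n) :
    rad z x < n ↔ ∀ j, |x j - z j| < (n : ℤ) := by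
  simp only [rad, Finset.sup_lt_iff (show (⊥ : ℕ) < n from hn), Finset.mem_univ, true_imp_iff]
  exact forall_congr' fun j => by rw [Int.abs_eq_natAbs]; omega

@[simp] theorem rad_self (z : Site d) : rad z z = 0 :=
  Nat.le_zero.1 (rad_le_iff.2 (by simp))

theorem vec_apply (e : Dir d) (j : Fin d) :
    e.vec j = if j = e.1 then (if e.2 then 1 else -1) else 0 := by
  simp [Dir.vec, Pi.single_apply]

theorem abs_vec_le (e : Dir d) (j : Fin d) : |e.vec j| ≤ 1 := by
  rw [vec_apply]; split_ifs <;> simp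

theorem rad_add_vec_le (z x : Site d) (e : Dir d) : rad z (x + e.vec) ≤ rad z x + 1 := by
  rw [rad_le_iff]
  intro j
  have h1 := (rad_le_iff.1 (le_refl (rad z x))) j
  have h2 := abs_vec_le e j
  rw [abs_le] at *
  simp only [Pi.add_apply]
  push_cast
  constructor <;> linarith [h1.1, h1.2, h2.1, h2.2]

theorem rad_refl_le (N : ℕ) (z x : Site d) (e : Dir d) : rad z (refl N x e) ≤ rad z x + 1 := by
  unfold refl
  split_ifs
  · exact rad_add_vec_le z x e
  · omega

theorem refl_mem_cube {N : ℕ} {x : Site d} (hx : x ∈ cube d N) (e : Dir d) :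
    refl N x e ∈ cube d N := by
  unfold refl
  split_ifs with h
  exacts [h, hx]

/-- One step up on `[0, N)`, reflected at the upper end. -/
def stepUp (N : ℕ) (a : ℤ) : ℤ := if a + 1 < N then a + 1 else a

/-- One step down on `[0, N)`, reflected at the lower end. -/
def stepDown (a : ℤ) : ℤ := if 0 ≤ a - 1 then a - 1 else a

theorem refl_true {N : ℕ} {x : Site d} (hx : x ∈ cube d N) (j : Fin d) :
    refl N x (j, true) = Function.update x j (stepUp N (x j)) := by
  have h : x + Dir.vec (j, true) = Function.update x j (x j + 1) := by
    ext l
    by_cases hl : l = j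
    · subst hl; simp [vec_apply]
    · simp [vec_apply, hl]
  have hmem : x + Dir.vec (j, true) ∈ cube d N ↔ x j + 1 < N := by
    rw [h]
    constructor
    · intro h; simpa using (h j).2
    · intro h l
      by_cases hl : l = j
      · subst hl; simp only [Function.update_self]; exact ⟨by linarith [(hx l).1], h⟩
      · simpa [Function.update_of_ne hl] using hx l
  unfold refl stepUp
  simp only [hmem]
  split_ifs
  · exact h
  · simp

theorem refl_false {N : ℕ} {x : Site d} (hx : x ∈ cube d N) (j : Fin d) :
    refl N x (j, false) = Function.update x j (stepDown (x j)) := by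
  have h : x + Dir.vec (j, false) = Function.update x j (x j - 1) := by
    ext l
    by_cases hl : l = j
    · subst hl; simp [vec_apply, sub_eq_add_neg]
    · simp [vec_apply, hl]
  have hmem : x + Dir.vec (j, false) ∈ cube d N ↔ 0 ≤ x j - 1 := by
    rw [h]
    constructor
    · intro h; simpa using (h j).1
    · intro h l
      by_cases hl : l = j
      · subst hl; simp only [Function.update_self]; exact ⟨h, by linarith [(hx l).2]⟩
      · simpa [Function.update_of_ne hl] using hx l
  unfold refl stepDown
  simp only [hmem]
  split_ifs
  · exact h
  · simp

/-- A set of sites of the cube which the reflected walk cannot leave. -/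
structure IsReflClosed (ω : Env d) (N : ℕ) (S : Set (Site d)) : Prop where
  subset : S ⊆ cube d N
  closed : ∀ x ∈ S, ∀ e, 0 < ω.prob x e → refl N x e ∈ S

theorem sum_axis_prob {ω : Env d} (hω : Balanced ω) (x : Site d) :
    ∑ j, ω.prob x (j, true) = 1 / 2 := by
  have h := sum_prob ω x
  rw [Fintype.sum_prod_type] at h
  simp only [Fintype.sum_bool] at h
  have h2 : ∀ j, ω.prob x (j, false) = ω.prob x (j, true) := fun j => hω x (j, false)
  simp only [h2, Finset.sum_add_distrib] at h
  linarith

/-- The one-step mean of a sum of functions of one coordinate. -/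
theorem sum_prob_mul_refl {ω : Env d} (hω : Balanced ω) {N : ℕ} {x : Site d}
    (hx : x ∈ cube d N) (F : Fin d → ℤ → ℝ) :
    ∑ e, ω.prob x e * ∑ j, F j (refl N x e j) = ∑ j, F j (x j) +
      ∑ j, ω.prob x (j, true) *
        ((F j (stepUp N (x j)) - F j (x j)) + (F j (stepDown (x j)) - F j (x j))) := by
  have key : ∀ (j : Fin d) (a : ℤ), ∑ l, F l (Function.update x j a l) =
      ∑ l, F l (x l) + (F j a - F j (x j)) := by
    intro j a
    rw [← Finset.add_sum_erase _ _ (Finset.mem_univ j),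
      ← Finset.add_sum_erase Finset.univ (fun l => F l (x l)) (Finset.mem_univ j)]
    have : ∑ l ∈ Finset.univ.erase j, F l (Function.update x j a l) =
        ∑ l ∈ Finset.univ.erase j, F l (x l) :=
      Finset.sum_congr rfl fun l hl => by rw [Function.update_of_ne (Finset.ne_of_mem_erase hl)]
    rw [this, Function.update_self]; ring
  rw [Fintype.sum_prod_type]
  simp only [Fintype.sum_bool, refl_true hx, refl_false hx, key]
  have h2 : ∀ j, ω.prob x (j, false) = ω.prob x (j, true) := fun j => hω x (j, false)
  simp only [h2]
  have h3 : ∀ j, ω.prob x (j, true) * (∑ l, F l (x l) + (F j (stepUp N (x j)) - F j (x j))) +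
      ω.prob x (j, true) * (∑ l, F l (x l) + (F j (stepDown (x j)) - F j (x j))) =
      ω.prob x (j, true) * (2 * ∑ l, F l (x l)) + ω.prob x (j, true) *
        ((F j (stepUp N (x j)) - F j (x j)) + (F j (stepDown (x j)) - F j (x j))) := fun j => by ring
  simp only [h3, Finset.sum_add_distrib, ← Finset.sum_mul, sum_axis_prob hω]
  ring

/-! ### The stopped reflected walk and its transition operator -/

section StopOp

variable (ω : Env d) (N : ℕ) (z : Site d) (n : ℕ) (i : Fin d)

/-- The walk is stopped at distance `n` from `z` and at the sites where the axis `i` is used. -/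
def Stopped (x : Site d) : Prop := n ≤ rad z x ∨ 0 < ω.prob x (i, true)

open Classical in
/-- The transition operator of the stopped reflected walk. -/
noncomputable def stopOp : (Site d → ℝ) →ₗ[ℝ] (Site d → ℝ) where
  toFun f x := if Stopped ω z n i x then f x else ∑ e, ω.prob x e * f (refl N x e)
  map_add' f g := by
    ext x
    simp only [Pi.add_apply]
    split_ifs
    · rfl
    · simp [mul_add, Finset.sum_add_distrib]
  map_smul' c f := by
    ext x
    simp only [Pi.smul_apply, smul_eq_mul, RingHom.id_apply]
    split_ifs
    · rfl
    · rw [Finset.mul_sum]; exact Finset.sum_congr rfl fun e _ => by ring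

/-- Sets that the stopped walk cannot leave. -/
def StopClosed (D : Set (Site d)) : Prop :=
  ∀ x ∈ D, ¬ Stopped ω z n i x → ∀ e, 0 < ω.prob x e → refl N x e ∈ D

variable {ω N z n i}

theorem stopOp_of_stopped {x : Site d} (hx : Stopped ω z n i x) (f : Site d → ℝ) :
    stopOp ω N z n i f x = f x := if_pos hx

theorem stopOp_of_not_stopped {x : Site d} (hx : ¬ Stopped ω z n i x) (f : Site d → ℝ) :
    stopOp ω N z n i f x = ∑ e, ω.prob x e * f (refl N x e) := if_neg hx

/-- The comparison is needed on D only, because the steps leaving D have weight zero. This lets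
hypotheses about S alone control expectations. -/
theorem stopOp_mono {D : Set (Site d)} (hD : StopClosed ω N z n i D) {f g : Site d → ℝ}
    (h : ∀ x ∈ D, f x ≤ g x) : ∀ x ∈ D, stopOp ω N z n i f x ≤ stopOp ω N z n i g x := by
  intro x hx
  by_cases hs : Stopped ω z n i x
  · rw [stopOp_of_stopped hs, stopOp_of_stopped hs]; exact h x hx
  · rw [stopOp_of_not_stopped hs, stopOp_of_not_stopped hs]
    refine Finset.sum_le_sum fun e _ => ?_
    rcases (prob_nonneg ω x e).eq_or_lt with h0 | h0
    · simp [← h0]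
    · exact mul_le_mul_of_nonneg_left (h _ (hD x hx hs e h0)) h0.le

theorem stopOp_pow_mono {D : Set (Site d)} (hD : StopClosed ω N z n i D) (k : ℕ)
    {f g : Site d → ℝ} (h : ∀ x ∈ D, f x ≤ g x) :
    ∀ x ∈ D, (stopOp ω N z n i ^ k) f x ≤ (stopOp ω N z n i ^ k) g x := by
  induction k with
  | zero => simpa using h
  | succ k ih =>
    simp only [pow_succ', Module.End.mul_apply]
    exact stopOp_mono hD ih

theorem stopOp_const (c : ℝ) : stopOp ω N z n i (fun _ => c) = fun _ => c := by
  ext x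
  by_cases hs : Stopped ω z n i x
  · rw [stopOp_of_stopped hs]
  · rw [stopOp_of_not_stopped hs, ← Finset.sum_mul, sum_prob, one_mul]

theorem stopOp_pow_const (k : ℕ) (c : ℝ) :
    (stopOp ω N z n i ^ k) (fun _ => c) = fun _ => c := by
  induction k with
  | zero => simp
  | succ k ih => rw [pow_succ', Module.End.mul_apply, ih, stopOp_const]

theorem le_stopOp_pow {D : Set (Site d)} (hD : StopClosed ω N z n i D) {f : Site d → ℝ}
    (h : ∀ x ∈ D, f x ≤ stopOp ω N z n i f x) (k : ℕ) :
    ∀ x ∈ D, f x ≤ (stopOp ω N z n i ^ k) f x := by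
  induction k with
  | zero => simp
  | succ k ih =>
    intro x hx
    rw [pow_succ, Module.End.mul_apply]
    exact (ih x hx).trans (stopOp_pow_mono hD k h x hx)

open Classical in
/-- The indicator function of the sites where the walk is not stopped. -/
noncomputable def running (ω : Env d) (z : Site d) (n : ℕ) (i : Fin d) (x : Site d) : ℝ :=
  if Stopped ω z n i x then 0 else 1

/-- A stopped walk never restarts, so the probability of still running can only decrease with time.
-/
theorem stopOp_running_le (x : Site d) :
    stopOp ω N z n i (running ω z n i) x ≤ running ω z n i x := by
  by_cases hs : Stopped ω z n i x
  · rw [stopOp_of_stopped hs]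
  · rw [stopOp_of_not_stopped hs]
    calc ∑ e, ω.prob x e * running ω z n i (refl N x e) ≤ ∑ e, ω.prob x e * 1 := by
          refine Finset.sum_le_sum fun e _ =>
            mul_le_mul_of_nonneg_left ?_ (prob_nonneg ω x e)
          unfold running; split_ifs <;> norm_num
      _ = running ω z n i x := by rw [← Finset.sum_mul, sum_prob, running, if_neg hs, one_mul]

/-- A bounded function that increases by `c` at each step bounds the probability that the walk is
still running after `k` steps. -/
theorem mul_running_le {D : Set (Site d)} (hD : StopClosed ω N z n i D) {f : Site d → ℝ}
    {c B : ℝ} (hc : 0 ≤ c) (h0 : ∀ x ∈ D, 0 ≤ f x) (hB : ∀ x ∈ D, f x ≤ B)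
    (hf : ∀ x ∈ D, f x + c * running ω z n i x ≤ stopOp ω N z n i f x) (k : ℕ) :
    ∀ x ∈ D, c * k * (stopOp ω N z n i ^ k) (running ω z n i) x ≤ B := by
  -- The gains of the k steps are c times the running probabilities at times 0, ..., k - 1; as these
  -- decrease, each is at least the running probability at time k.
  have key : ∀ x ∈ D, f x + c * k * (stopOp ω N z n i ^ k) (running ω z n i) x ≤
      (stopOp ω N z n i ^ k) f x := by
    induction k with
    | zero => simp
    | succ k ih =>
      intro x hx
      have h1 := stopOp_pow_mono hD k (g := stopOp ω N z n i f)
        (f := f + c • running ω z n i) hf x hx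
      rw [map_add, map_smul, ← Module.End.mul_apply, ← pow_succ] at h1
      simp only [Pi.add_apply, Pi.smul_apply, smul_eq_mul] at h1
      have h2 : (stopOp ω N z n i ^ (k + 1)) (running ω z n i) x ≤
          (stopOp ω N z n i ^ k) (running ω z n i) x := by
        rw [pow_succ, Module.End.mul_apply]
        exact stopOp_pow_mono (D := Set.univ) (fun _ _ _ _ _ => trivial) k
          (fun y _ => stopOp_running_le y) x trivial
      have h3 := ih x hx
      have h4 : c * (k + 1) * (stopOp ω N z n i ^ (k + 1)) (running ω z n i) x ≤
          c * (k + 1) * (stopOp ω N z n i ^ k) (running ω z n i) x :=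
        mul_le_mul_of_nonneg_left h2 (by positivity)
      push_cast
      linarith
  intro x hx
  have h1 := stopOp_pow_mono hD k (g := fun _ => B) hB x hx
  rw [stopOp_pow_const] at h1
  have := key x hx
  have := h0 x hx
  linarith

/-- The indicator function of the sites at distance at least `n` from `z`. -/
noncomputable def outside (z : Site d) (n : ℕ) (x : Site d) : ℝ := if n ≤ rad z x then 1 else 0

end StopOp

/-! ### Contact points of paraboloids and their slopes -/

/-- The difference between a concave paraboloid and its value at `z`. -/
def paraboloid (t : Fin d → ℤ) (z y : Site d) : ℤ := ∑ j, (t j * (y j - z j) - (y j - z j) ^ 2)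

/-- While the walk runs, axis i is inactive and by balance both of its directions have probability
zero. The i-th coordinate therefore stays that of z until the walk stops. -/
theorem stopClosed_of_isReflClosed {ω : Env d} (hω : Balanced ω) {N : ℕ} {S : Set (Site d)}
    (hS : IsReflClosed ω N S) (z : Site d) (n : ℕ) (i : Fin d) :
    StopClosed ω N z n i {x | x ∈ S ∧ rad z x ≤ n ∧ x i = z i} := by
  rintro x ⟨hxS, hxr, hxi⟩ hs e he
  have hr : rad z x < n := not_le.1 fun h => hs (Or.inl h)
  have hi : ¬ 0 < ω.prob x (i, true) := fun h => hs (Or.inr h)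
  refine ⟨hS.closed x hxS e he, (rad_refl_le N z x e).trans hr, ?_⟩
  obtain ⟨j, b⟩ := e
  have hj : i ≠ j := by
    rintro rfl
    cases b
    · exact hi (by rw [hω x (i, true)]; exact he)
    · exact hi he
  cases b
  · rw [refl_false (hS.subset hxS), Function.update_of_ne hj, hxi]
  · rw [refl_true (hS.subset hxS), Function.update_of_ne hj, hxi]

/-- If the reflected walk started at `z` is likely to find a site with an active axis `i` before
it exits from the box of radius `n`, then there is such a site in every closed set containing `z`
at which a paraboloid that is maximal at `z` is not too small. -/
theorem exists_active {ω : Env d} (hω : Balanced ω) {N : ℕ} {S : Set (Site d)}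
    (hS : IsReflClosed ω N S) {z : Site d} (hz : z ∈ S) {n : ℕ} (hn : 0 < n) (hnN : 2 * n ≤ N)
    (i : Fin d) (t : Fin d → ℤ) (hlow : ∀ j, z j < n → 0 ≤ t j)
    (hup : ∀ j, (N : ℤ) - 1 - z j < n → t j ≤ 0)
    (hmax : ∀ y ∈ S, paraboloid t z y ≤ 0)
    (hgood : (stopOp ω N z n i ^ (32 * d * n ^ 2)) (outside z n) z ≤ 1 / 4) :
    ∃ y ∈ S, y i = z i ∧ 0 < ω.prob y (i, true) ∧ -(2 * d * n ^ 2 : ℤ) ≤ paraboloid t z y := by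
  by_contra hcon
  push Not at hcon
  set D : Set (Site d) := {x | x ∈ S ∧ rad z x ≤ n ∧ x i = z i} with hDdef
  have hD : StopClosed ω N z n i D := stopClosed_of_isReflClosed hω hS z n i
  have hzD : z ∈ D := ⟨hz, by simp, rfl⟩
  set k := 32 * d * n ^ 2 with hk
  have hd : 0 < d := i.pos
  set T := stopOp ω N z n i with hT
  -- the running probability
  set a : Fin d → ℤ := fun j => if z j < n then z j - n else z j + n with ha
  -- The centre `a` lies below the walk if it can touch only a lower face, and above it otherwise
  -- (`2 * n ≤ N` excludes both faces). A reflection then suppresses only a step that would approach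
  -- `a`, so the squared distance still gains at least 1/2 in mean per step. It is at most 4dn^2,
  -- and k = 32dn^2 steps turn this into the bound 1/4.
  have hrun : (T ^ k) (running ω z n i) z ≤ 1 / 4 := by
    have h := mul_running_le hD (f := fun x => ∑ j, ((x j - a j : ℤ) : ℝ) ^ 2) (c := 1 / 2)
      (B := d * (2 * n) ^ 2) (by norm_num) (fun x _ => Finset.sum_nonneg fun j _ => sq_nonneg _)
      ?_ ?_ k z hzD
    · rw [hk] at h
      push_cast at h
      have : (0 : ℝ) < d * n ^ 2 := by positivity
      rw [← hk] at h
      by_contra hc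
      push Not at hc
      nlinarith
    · intro x hx
      calc ∑ j, ((x j - a j : ℤ) : ℝ) ^ 2 ≤ ∑ j : Fin d, (2 * n : ℝ) ^ 2 := by
            refine Finset.sum_le_sum fun j _ => ?_
            have h1 := abs_le.1 (rad_le_iff.1 hx.2.1 j)
            have h2 : |x j - a j| ≤ 2 * n := by
              rw [abs_le, ha]; dsimp only; split_ifs <;> constructor <;> omega
            have h3 : |((x j - a j : ℤ) : ℝ)| ≤ 2 * n := by exact_mod_cast h2
            rw [← sq_abs]
            exact pow_le_pow_left₀ (abs_nonneg _) h3 2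
        _ = d * (2 * n) ^ 2 := by simp
    · intro x hx
      by_cases hs : Stopped ω z n i x
      · rw [stopOp_of_stopped hs, running, if_pos hs]; simp
      · have hxc := hS.subset hx.1
        rw [stopOp_of_not_stopped hs, running, if_neg hs,
          sum_prob_mul_refl hω hxc (fun j b => ((b - a j : ℤ) : ℝ) ^ 2)]
        have hr : rad z x < n := not_le.1 fun h => hs (Or.inl h)
        have : ∑ j, ω.prob x (j, true) * 1 ≤ ∑ j, ω.prob x (j, true) *
            ((((stepUp N (x j) - a j : ℤ) : ℝ) ^ 2 - ((x j - a j : ℤ) : ℝ) ^ 2) +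
            (((stepDown (x j) - a j : ℤ) : ℝ) ^ 2 - ((x j - a j : ℤ) : ℝ) ^ 2)) := by
          refine Finset.sum_le_sum fun j _ => mul_le_mul_of_nonneg_left ?_ (prob_nonneg _ _ _)
          have h1 := abs_lt.1 ((rad_lt_iff hn).1 hr j)
          have h2 := hxc j
          norm_cast
          unfold stepUp stepDown
          simp only [ha]
          split_ifs <;> first | (exfalso; omega) | nlinarith
        rw [Finset.sum_congr rfl fun j _ => mul_one _, sum_axis_prob hω] at this
        linarith
  -- the mean of the paraboloid
  have hlin : 0 ≤ (T ^ k) (fun x => ∑ j, ((t j * (x j - z j) : ℤ) : ℝ)) z := by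
    -- The linear part is a submartingale: opposite steps cancel in the interior, and at a face the
    -- suppressed step is one that `hlow` or `hup` shows could not raise it.
    have h := le_stopOp_pow hD (f := fun x => ∑ j, ((t j * (x j - z j) : ℤ) : ℝ)) ?_ k z hzD
    · simpa using h
    · intro x hx
      by_cases hs : Stopped ω z n i x
      · rw [stopOp_of_stopped hs]
      · have hxc := hS.subset hx.1
        rw [stopOp_of_not_stopped hs,
          sum_prob_mul_refl hω hxc (fun j b => ((t j * (b - z j) : ℤ) : ℝ))]
        have hr : rad z x < n := not_le.1 fun h => hs (Or.inl h)
        refine le_add_of_nonneg_right (Finset.sum_nonneg fun j _ => ?_)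
        refine mul_nonneg (prob_nonneg _ _ _) ?_
        have h1 := abs_lt.1 ((rad_lt_iff hn).1 hr j)
        have h2 := hxc j
        have h3 := hlow j
        have h4 := hup j
        norm_cast
        unfold stepUp stepDown
        split_ifs
        · nlinarith
        · have := h3 (by omega); nlinarith
        · have := h4 (by omega); nlinarith
        · nlinarith
  have hquad : (T ^ k) (fun x => ∑ j, ((x j - z j : ℤ) : ℝ) ^ 2) z ≤ d * n ^ 2 := by
    have h := stopOp_pow_mono hD k (f := fun x => ∑ j, ((x j - z j : ℤ) : ℝ) ^ 2)
      (g := fun _ => (d * n ^ 2 : ℝ)) ?_ z hzD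
    · rwa [stopOp_pow_const] at h
    · intro x hx
      calc ∑ j, ((x j - z j : ℤ) : ℝ) ^ 2 ≤ ∑ j : Fin d, (n : ℝ) ^ 2 := by
            refine Finset.sum_le_sum fun j _ => ?_
            have h3 : |((x j - z j : ℤ) : ℝ)| ≤ n := by exact_mod_cast rad_le_iff.1 hx.2.1 j
            rw [← sq_abs]
            exact pow_le_pow_left₀ (abs_nonneg _) h3 2
        _ = d * n ^ 2 := by simp
  -- This mean contradicts `hcon`: the walk is outside or still running with probability at most 1/4
  -- + 1/4, so with probability at least 1/2 it sits at an active site, where the value would be at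
  -- most -(2dn^2 + 1). As the paraboloid is nonpositive on S, its mean would be at most -(dn^2 +
  -- 1/2).
  have hv : -(d * n ^ 2 : ℝ) ≤ (T ^ k) (fun x => (paraboloid t z x : ℝ)) z := by
    have : (fun x => (paraboloid t z x : ℝ)) = (fun x => ∑ j, ((t j * (x j - z j) : ℤ) : ℝ)) -
        (fun x => ∑ j, ((x j - z j : ℤ) : ℝ) ^ 2) := by
      ext x
      simp only [paraboloid, Pi.sub_apply, ← Finset.sum_sub_distrib]
      push_cast
      rfl
    rw [this, map_sub, Pi.sub_apply]
    linarith
  -- the contradiction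
  have hcmp := stopOp_pow_mono hD k (f := fun x => (paraboloid t z x : ℝ))
    (g := (2 * d * n ^ 2 + 1 : ℝ) • (outside z n + running ω z n i - fun _ => 1)) ?_ z hzD
  · rw [map_smul, map_sub, map_add, stopOp_pow_const] at hcmp
    simp only [Pi.add_apply, Pi.smul_apply, Pi.sub_apply, smul_eq_mul] at hcmp
    have h0 : (0 : ℝ) ≤ 2 * d * n ^ 2 := by positivity
    change (T ^ k) (outside z n) z ≤ 1 / 4 at hgood
    rw [← hT] at hcmp
    nlinarith
  · rintro x ⟨hxS, hxr, hxi⟩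
    have h0 : (paraboloid t z x : ℝ) ≤ 0 := by exact_mod_cast hmax x hxS
    have hp : (0 : ℝ) ≤ 2 * d * n ^ 2 := by positivity
    simp only [Pi.add_apply, Pi.smul_apply, Pi.sub_apply, smul_eq_mul, outside, running]
    by_cases h1 : n ≤ rad z x
    · rw [if_pos h1]
      split_ifs <;> nlinarith
    · rw [if_neg h1]
      by_cases h2 : Stopped ω z n i x
      · rw [if_pos h2]
        have h3 := hcon x hxS hxi (h2.resolve_left h1)
        have h4 : paraboloid t z x + 1 ≤ -(2 * d * n ^ 2 : ℤ) := h3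
        have h5 : (paraboloid t z x : ℝ) + 1 ≤ -(2 * d * n ^ 2 : ℝ) := by exact_mod_cast h4
        linarith
      · rw [if_neg h2]; linarith

/-- The slope of a paraboloid that is maximal at `z` on a closed set is small. -/
theorem abs_slope_le {ω : Env d} (hω : Balanced ω) {N : ℕ} {S : Set (Site d)}
    (hS : IsReflClosed ω N S) {z : Site d} (hz : z ∈ S) {n : ℕ} (hn : 0 < n) (hnN : 2 * n ≤ N)
    (i : Fin d) (t : Fin d → ℤ) (hlow : ∀ j, z j < n → 0 ≤ t j)
    (hup : ∀ j, (N : ℤ) - 1 - z j < n → t j ≤ 0)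
    (hmax : ∀ y ∈ S, paraboloid t z y ≤ 0)
    (hgood : (stopOp ω N z n i ^ (32 * d * n ^ 2)) (outside z n) z ≤ 1 / 4) :
    |t i| ≤ 2 * d * n ^ 2 + 1 := by
  obtain ⟨y, hyS, hyi, hact, hy⟩ := exists_active hω hS hz hn hnN i t hlow hup hmax hgood
  have hyc := hS.subset hyS
  have key : ∀ b : ℤ, paraboloid t z (Function.update y i b) = paraboloid t z y +
      (t i * (b - z i) - (b - z i) ^ 2) := by
    intro b
    unfold paraboloid
    rw [← Finset.add_sum_erase _ _ (Finset.mem_univ i), ← Finset.add_sum_erase Finset.univ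
      (fun j => t j * (y j - z j) - (y j - z j) ^ 2) (Finset.mem_univ i)]
    have : ∑ j ∈ Finset.univ.erase i, (t j * (Function.update y i b j - z j) -
        (Function.update y i b j - z j) ^ 2) =
        ∑ j ∈ Finset.univ.erase i, (t j * (y j - z j) - (y j - z j) ^ 2) :=
      Finset.sum_congr rfl fun l hl => by rw [Function.update_of_ne (Finset.ne_of_mem_erase hl)]
    rw [this, Function.update_self, hyi]; ring
  -- Both moves along i from y stay in S, where the paraboloid is at most 0. An unblocked move
  -- changes its value, at least -2dn^2 at y, by ±t_i - 1, which bounds t_i on that side. A blocked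
  -- move means that z is near that face, and then `hlow` or `hup` supplies the missing bound.
  have h1 := hmax _ (hS.closed y hyS (i, true) hact)
  have h2 := hmax _ (hS.closed y hyS (i, false) (by rw [hω y (i, false)]; exact hact))
  rw [refl_true hyc, key] at h1
  rw [refl_false hyc, key] at h2
  have h3 := hyc i
  have h4 := hlow i
  have h5 := hup i
  unfold stepUp at h1
  unfold stepDown at h2
  rw [hyi] at h1 h2 h3
  rw [abs_le]
  have hp : (0 : ℤ) ≤ 2 * d * n ^ 2 := by positivity
  constructor
  · split_ifs at h2 with h
    · ring_nf at h2 ⊢; linarith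
    · have := h4 (by omega); linarith
  · split_ifs at h1 with h
    · ring_nf at h1 ⊢; linarith
    · have := h5 (by omega); linarith

/-- The cube `[0, N)^d` as a finite set. -/
noncomputable def cubeFinset (d N : ℕ) : Finset (Site d) := Fintype.piFinset fun _ => Finset.Ico 0 (N : ℤ)

theorem mem_cubeFinset {N : ℕ} {z : Site d} : z ∈ cubeFinset d N ↔ z ∈ cube d N := by
  simp [cubeFinset, cube]

theorem coe_cubeFinset (d N : ℕ) : (cubeFinset d N : Set (Site d)) = cube d N := by
  ext; simp [mem_cubeFinset]

theorem card_cubeFinset (d N : ℕ) : (cubeFinset d N).card = N ^ d := by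
  simp [cubeFinset]

theorem IsReflClosed.finite {ω : Env d} {N : ℕ} {S : Set (Site d)} (hS : IsReflClosed ω N S) :
    S.Finite :=
  (Finset.finite_toSet (cubeFinset d N)).subset (by rw [coe_cubeFinset]; exact hS.subset)

/-- The number of slopes in a cube is at most the total number of slopes of paraboloids that touch
a closed set from above, counted by the point of contact. -/
theorem card_slopes_le {ω : Env d} (hω : Balanced ω) {N : ℕ} {S : Finset (Site d)}
    (hS : IsReflClosed ω N S) (hne : S.Nonempty) (r : Site d → ℕ) (hr : ∀ z ∈ S, 0 < r z)
    (hrN : ∀ z ∈ S, 16 * r z ≤ N)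
    (hgood : ∀ z ∈ S, ∀ i,
      (stopOp ω N z (r z) i ^ (32 * d * r z ^ 2)) (outside z (r z)) z ≤ 1 / 4) :
    (2 * (N / 4) + 1) ^ d ≤ ∑ z ∈ S, (4 * d * r z ^ 2 + 3) ^ d := by
  classical
  set A : Finset (Fin d → ℤ) :=
    Fintype.piFinset fun _ => Finset.Icc (-((N / 4 : ℕ) : ℤ)) ((N / 4 : ℕ) : ℤ) with hA
  have hcard : A.card = (2 * (N / 4) + 1) ^ d := by
    rw [hA, Fintype.card_piFinset]
    simp only [Int.card_Icc, Finset.prod_const, Finset.card_univ, Fintype.card_fin]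
    congr 1; omega
  -- The peak has coordinates (N - 1 - p_j)/2. For |p_j| ≤ N/4 it is so central that a contact point
  -- within N/16 of a face has its slope N - 1 - p_j - 2 z_j pointing inwards, as `abs_slope_le`
  -- requires.
  have hex : ∀ p : Fin d → ℤ, ∃ z ∈ S, ∀ y ∈ S,
      ∑ j, ((N - 1 - p j) * y j - y j ^ 2) ≤ ∑ j, ((N - 1 - p j) * z j - z j ^ 2) := fun p =>
    S.exists_max_image _ hne
  choose f hfS hfmax using hex
  rw [← hcard, Finset.card_eq_sum_card_fiberwise (t := S) (fun p _ => hfS p)]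
  refine Finset.sum_le_sum fun z hz => ?_
  -- For a fixed contact point the slope determines p, so the slope bound leaves 2(2dr^2 + 1) + 1 =
  -- 4dr^2 + 3 values of each p_j.
  have hsub : A.filter (fun p => f p = z) ⊆ Fintype.piFinset fun j =>
      Finset.Icc ((N : ℤ) - 1 - 2 * z j - (2 * d * r z ^ 2 + 1))
        ((N : ℤ) - 1 - 2 * z j + (2 * d * r z ^ 2 + 1)) := by
    intro p hp
    rw [Finset.mem_filter] at hp
    obtain ⟨hpA, rfl⟩ := hp
    rw [Fintype.mem_piFinset]
    intro i
    have hpj : ∀ j, -((N / 4 : ℕ) : ℤ) ≤ p j ∧ p j ≤ ((N / 4 : ℕ) : ℤ) := fun j => by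
      simpa using Fintype.mem_piFinset.1 hpA j
    have h16 := hrN _ hz
    have h := abs_slope_le hω hS hz (hr _ hz) (by omega) i
      (fun j => (N : ℤ) - 1 - p j - 2 * f p j) (fun j hj => by have := hpj j; omega)
      (fun j hj => by have := hpj j; omega) ?_ (hgood _ hz i)
    · rw [Finset.mem_Icc]
      rw [abs_le] at h
      constructor <;> linarith [h.1, h.2]
    · intro y hy
      have h1 := hfmax p y hy
      rw [← sub_nonpos, ← Finset.sum_sub_distrib] at h1
      unfold paraboloid
      refine le_of_eq_of_le (Finset.sum_congr rfl fun j _ => ?_) h1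
      ring
  refine (Finset.card_le_card hsub).trans (le_of_eq ?_)
  rw [Fintype.card_piFinset]
  simp only [Int.card_Icc]
  have : ∀ j, ((N : ℤ) - 1 - 2 * z j + (2 * d * r z ^ 2 + 1) + 1 -
      ((N : ℤ) - 1 - 2 * z j - (2 * d * r z ^ 2 + 1))).toNat = 4 * d * r z ^ 2 + 3 := by
    intro j
    have : ((N : ℤ) - 1 - 2 * z j + (2 * d * r z ^ 2 + 1) + 1 -
      ((N : ℤ) - 1 - 2 * z j - (2 * d * r z ^ 2 + 1))) = ((4 * d * r z ^ 2 + 3 : ℕ) : ℤ) := by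
      push_cast; ring
    rw [this, Int.toNat_natCast]
  simp [this]

/-! ### Good scales and the size of closed sets -/

/-- The walk started at `z` has a probability larger than `1 / 4` to exit from the box of radius
`n` without having seen an active axis `i`, for some `i`. -/
def Bad (ω : Env d) (N n : ℕ) (z : Site d) : Prop :=
  ∃ i, 1 / 4 < (stopOp ω N z n i ^ (32 * d * n ^ 2)) (outside z n) z

/-- The square of the number of slopes at scale `n`. -/
def slopeWeight (d n : ℕ) : ℝ := ((4 * d * n ^ 2 + 3 : ℝ) ^ d) ^ 2

open Classical in
/-- A bound for the squared number of slopes at `z`. -/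
noncomputable def slopeBound (ω : Env d) (N : ℕ) (z : Site d) : ℝ :=
  slopeWeight d 1 + ∑ n ∈ Finset.Ico 1 (N / 16), slopeWeight d (n + 1) *
    if Bad ω N n z then 1 else 0

theorem slopeWeight_nonneg (d n : ℕ) : 0 ≤ slopeWeight d n := sq_nonneg _

/-- The least good scale works: it is either 1 or the successor of a bad scale, and in both cases
its weight is a term of `slopeBound`. The hypothesis at N/16 guarantees that a good scale exists and
meets the size condition. -/
theorem exists_scale {ω : Env d} {N : ℕ} (hN : 16 ≤ N) {z : Site d}
    (hlast : ¬ Bad ω N (N / 16) z) :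
    ∃ r : ℕ, 0 < r ∧ 16 * r ≤ N ∧ ¬ Bad ω N r z ∧ slopeWeight d r ≤ slopeBound ω N z := by
  classical
  have hex : ∃ r, 0 < r ∧ ¬ Bad ω N r z := ⟨N / 16, by omega, hlast⟩
  have hle : Nat.find hex ≤ N / 16 := Nat.find_min' hex ⟨by omega, hlast⟩
  obtain ⟨h0, hb⟩ := Nat.find_spec hex
  refine ⟨Nat.find hex, h0, by omega, hb, ?_⟩
  have hnn : ∀ n ∈ Finset.Ico 1 (N / 16), 0 ≤ slopeWeight d (n + 1) *
      (if Bad ω N n z then 1 else 0 : ℝ) := fun n _ => by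
    split_ifs <;> simp [slopeWeight_nonneg]
  rcases Nat.eq_or_lt_of_le (show 1 ≤ Nat.find hex from h0) with h1 | h1
  · rw [← h1]
    exact le_add_of_nonneg_right (Finset.sum_nonneg hnn)
  · obtain ⟨m, hm⟩ : ∃ m, Nat.find hex = m + 1 := ⟨Nat.find hex - 1, by omega⟩
    have hbm : Bad ω N m z := by
      by_contra hc
      exact Nat.find_min hex (m := m) (by omega) ⟨by omega, hc⟩
    have := Finset.single_le_sum hnn (show m ∈ Finset.Ico 1 (N / 16) by
      rw [Finset.mem_Ico]; omega)
    rw [if_pos hbm, mul_one] at this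
    rw [hm]
    exact this.trans (le_add_of_nonneg_left (slopeWeight_nonneg _ _))

/-- A closed set of the reflected walk has a positive density in the cube if the bounds for the
numbers of slopes are bounded in mean. -/
theorem IsReflClosed.card_ge {ω : Env d} (hω : Balanced ω) {N : ℕ} (hN : 16 ≤ N)
    {S : Set (Site d)} (hS : IsReflClosed ω N S) (hne : S.Nonempty)
    (hlast : ∀ z ∈ cube d N, ¬ Bad ω N (N / 16) z) {B : ℝ}
    (hB : ∑ z ∈ cubeFinset d N, slopeBound ω N z ≤ B * (N : ℝ) ^ d) :
    (N : ℝ) ^ d ≤ 16 ^ d * B * S.ncard := by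
  classical
  have hfin := hS.finite
  lift S to Finset (Site d) using hfin
  rw [Set.ncard_coe_finset]
  have hex : ∀ z : Site d, ∃ r : ℕ, z ∈ S → 0 < r ∧ 16 * r ≤ N ∧ ¬ Bad ω N r z ∧
      slopeWeight d r ≤ slopeBound ω N z := fun z => by
    by_cases hz : z ∈ S
    · obtain ⟨r, hr⟩ := exists_scale hN (hlast z (hS.subset hz))
      exact ⟨r, fun _ => hr⟩
    · exact ⟨0, fun h => absurd h hz⟩
  choose r hr using hex
  have h1 := card_slopes_le hω hS hne r (fun z hz => (hr z hz).1) (fun z hz => (hr z hz).2.1)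
    (fun z hz i => not_lt.1 fun h => (hr z hz).2.2.1 ⟨i, h⟩)
  have h2 : ((N : ℝ) / 4) ^ d ≤ ∑ z ∈ S, (4 * d * r z ^ 2 + 3 : ℝ) ^ d := by
    have h3 : ((2 * (N / 4) + 1 : ℕ) : ℝ) ^ d ≤ ∑ z ∈ S, (4 * d * r z ^ 2 + 3 : ℝ) ^ d := by
      exact_mod_cast h1
    refine le_trans (pow_le_pow_left₀ (by positivity) ?_ d) h3
    rw [div_le_iff₀ (by norm_num)]
    have : N ≤ (2 * (N / 4) + 1) * 4 := by omega
    exact_mod_cast this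
  -- Cauchy–Schwarz extracts the factor |S|. The remaining sum of squares may be enlarged from the
  -- unknown set S to the whole cube, where its average is controlled.
  have h4 : (((N : ℝ) / 4) ^ d) ^ 2 ≤ S.card * (B * (N : ℝ) ^ d) := by
    calc (((N : ℝ) / 4) ^ d) ^ 2 ≤ (∑ z ∈ S, (4 * d * r z ^ 2 + 3 : ℝ) ^ d) ^ 2 :=
          pow_le_pow_left₀ (by positivity) h2 2
      _ ≤ S.card * ∑ z ∈ S, ((4 * d * r z ^ 2 + 3 : ℝ) ^ d) ^ 2 := sq_sum_le_card_mul_sum_sq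
      _ ≤ S.card * (B * (N : ℝ) ^ d) := by
        refine mul_le_mul_of_nonneg_left (le_trans ?_ hB) (by positivity)
        calc ∑ z ∈ S, ((4 * d * r z ^ 2 + 3 : ℝ) ^ d) ^ 2 ≤ ∑ z ∈ S, slopeBound ω N z :=
              Finset.sum_le_sum fun z hz => (hr z hz).2.2.2
          _ ≤ ∑ z ∈ cubeFinset d N, slopeBound ω N z := by
            refine Finset.sum_le_sum_of_subset_of_nonneg
              (fun z hz => mem_cubeFinset.2 (hS.subset hz)) fun z _ _ => ?_
            refine add_nonneg (slopeWeight_nonneg _ _) (Finset.sum_nonneg fun n _ => ?_)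
            split_ifs <;> simp [slopeWeight_nonneg]
  have hNd : (0 : ℝ) < (N : ℝ) ^ d := by have : 0 < N := by omega
                                         positivity
  have h5 : (((N : ℝ) / 4) ^ d) ^ 2 = (N : ℝ) ^ d * (N : ℝ) ^ d / 16 ^ d := by
    rw [div_pow, div_pow, ← pow_mul, ← pow_mul, mul_comm d 2, pow_mul (4 : ℝ), mul_comm 2 d,
      pow_mul, sq]; norm_num
  rw [h5, div_le_iff₀ (by positivity)] at h4
  refine le_of_mul_le_mul_right ?_ hNd
  linarith

/-! ### Annealed rarity of bad boxes -/

instance (ν : Measure (LocalLaw d)) [IsProbabilityMeasure ν] :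
    IsProbabilityMeasure (envLaw ν) := by unfold envLaw; infer_instance

theorem measurable_localLaw_apply (e : Dir d) : Measurable fun l : LocalLaw d => l.1 e :=
  (measurable_pi_apply e).comp measurable_subtype_coe

/-- The probability vectors for which the axis `i` is not used. -/
def inactive (i : Fin d) : Set (LocalLaw d) := {l | ¬ 0 < l.1 (i, true)}

theorem measurableSet_inactive (i : Fin d) : MeasurableSet (inactive i) :=
  (measurableSet_lt measurable_const (measurable_localLaw_apply _)).compl

theorem stopped_iff (ω : Env d) (z : Site d) (n : ℕ) (i : Fin d) (x : Site d) :
    Stopped ω z n i x ↔ n ≤ rad z x ∨ ω x ∉ inactive i := by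
  simp [Stopped, inactive, Env.prob]

theorem measurable_stopOp {f : Env d → Site d → ℝ} (hf : ∀ x, Measurable fun ω => f ω x)
    (N : ℕ) (z : Site d) (n : ℕ) (i : Fin d) (x : Site d) :
    Measurable fun ω => stopOp ω N z n i (f ω) x := by
  classical
  have : (fun ω => stopOp ω N z n i (f ω) x) = fun ω => if Stopped ω z n i x then f ω x else
      ∑ e, ω.prob x e * f ω (refl N x e) := by
    ext ω
    split_ifs with h
    exacts [stopOp_of_stopped h _, stopOp_of_not_stopped h _]
  rw [this]
  refine Measurable.ite ?_ (hf x) (Finset.measurable_fun_sum _ fun e _ =>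
    (measurable_prob x e).mul (hf _))
  simp only [stopped_iff, Set.ofPred_or]
  have hx : Measurable fun ω : Env d => ω x := measurable_pi_apply x
  exact (MeasurableSet.const _).union (hx (measurableSet_inactive i)).compl

theorem measurable_stopOp_pow (f : Site d → ℝ) (N : ℕ) (z : Site d) (n : ℕ) (i : Fin d) (k : ℕ)
    (x : Site d) : Measurable fun ω => (stopOp ω N z n i ^ k) f x := by
  induction k generalizing x with
  | zero => simp
  | succ k ih =>
    simp only [pow_succ', Module.End.mul_apply]
    exact measurable_stopOp ih N z n i x

theorem lintegral_prod_envLaw (ν : Measure (LocalLaw d)) [IsProbabilityMeasure ν]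
    (B : Finset (Site d)) {g : Site d → LocalLaw d → ℝ≥0∞} (hg : ∀ x, Measurable (g x)) :
    ∫⁻ ω, ∏ x ∈ B, g x (ω x) ∂envLaw ν = ∏ x ∈ B, ∫⁻ l, g x l ∂ν := by
  unfold envLaw
  have h := lintegral_prod_eq_prod_lintegral_of_indepFun B (fun x (ω : Env d) => g x (ω x))
    (iIndepFun_infinitePi (P := fun _ : Site d => ν) hg)
    (fun x => (hg x).comp (measurable_pi_apply x))
  rw [h]
  refine Finset.prod_congr rfl fun x _ => ?_
  rw [← (measurePreserving_eval_infinitePi (fun _ : Site d => ν) x).lintegral_comp (hg x)]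

/-- A law carried by the inactive vectors that dominates a multiple of the restriction of `ν`. -/
theorem exists_conditioned (ν : Measure (LocalLaw d)) [IsProbabilityMeasure ν] (i : Fin d)
    {c : ℝ≥0∞} (hc : ν (inactive i) ≤ c) :
    ∃ ν' : Measure (LocalLaw d), IsProbabilityMeasure ν' ∧ ν.restrict (inactive i) ≤ c • ν' := by
  by_cases h0 : ν (inactive i) = 0
  · exact ⟨ν, inferInstance, by rw [Measure.restrict_eq_zero.2 h0]; exact Measure.zero_le _⟩
  · refine ⟨ProbabilityTheory.cond ν (inactive i), cond_isProbabilityMeasure h0, ?_⟩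
    rw [ProbabilityTheory.cond, smul_smul]
    intro s
    simp only [Measure.smul_apply, smul_eq_mul]
    calc ν.restrict (inactive i) s = 1 * ν.restrict (inactive i) s := (one_mul _).symm
      _ ≤ _ := by
        gcongr
        rw [← ENNReal.mul_inv_cancel h0 (measure_ne_top _ _)]
        gcongr

section Annealed

variable {ν ν' : Measure (LocalLaw d)} [IsProbabilityMeasure ν] [IsProbabilityMeasure ν']
  {i : Fin d} {c : ℝ≥0∞} {z : Site d} {n N : ℕ} {B : Finset (Site d)}

/-- Replacing ν by ν' gains a factor c at each site of V, since the weight there vanishes off the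
inactive vectors; elsewhere both integrals equal 1. -/
theorem lintegral_prod_le (hc1 : c ≤ 1) (hν' : ν.restrict (inactive i) ≤ c • ν')
    {V : Finset (Site d)} (hVB : V ⊆ B) (hVn : n ≤ V.card)
    {g : Site d → LocalLaw d → ℝ≥0∞} (hg : ∀ x, Measurable (g x))
    (hgV : ∀ x ∈ V, ∀ l ∉ inactive i, g x l = 0) (hg1 : ∀ x ∉ V, g x = 1) :
    ∫⁻ ω, ∏ x ∈ B, g x (ω x) ∂envLaw ν ≤ c ^ n * ∏ x ∈ B, ∫⁻ l, g x l ∂ν' := by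
  classical
  rw [lintegral_prod_envLaw ν B hg]
  calc ∏ x ∈ B, ∫⁻ l, g x l ∂ν ≤ ∏ x ∈ B, ((if x ∈ V then c else 1) * ∫⁻ l, g x l ∂ν') := by
        refine Finset.prod_le_prod' fun x _ => ?_
        split_ifs with hx
        · calc ∫⁻ l, g x l ∂ν = ∫⁻ l in inactive i, g x l ∂ν := by
                rw [setLIntegral_eq_of_support_subset]
                intro l hl
                by_contra hcon
                exact hl (hgV x hx l hcon)
            _ ≤ ∫⁻ l, g x l ∂(c • ν') := lintegral_mono' hν' le_rfl
            _ = c * ∫⁻ l, g x l ∂ν' := by rw [lintegral_smul_measure, smul_eq_mul]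
        · simp [hg1 x hx]
    _ = c ^ V.card * ∏ x ∈ B, ∫⁻ l, g x l ∂ν' := by
        rw [Finset.prod_mul_distrib, Finset.prod_ite_mem, Finset.inter_eq_right.2 hVB,
          Finset.prod_const]
    _ ≤ _ := by gcongr ?_ * _; exact pow_le_pow_right_of_le_one' hc1 hVn

/-- A walk that reaches distance n visits every smaller distance, hence n distinct sites. -/
theorem card_ge_of_rad {V : Finset (Site d)} (h : ∀ m < n, ∃ y ∈ V, rad z y = m) :
    n ≤ V.card := by
  classical
  calc n = (Finset.range n).card := by simp
    _ ≤ (V.image (rad z)).card := by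
      refine Finset.card_le_card fun m hm => ?_
      obtain ⟨y, hy, rfl⟩ := h m (Finset.mem_range.1 hm)
      exact Finset.mem_image_of_mem _ hy
    _ ≤ V.card := Finset.card_image_le

open Classical in
/-- Exploration of the environment along the stopped walk: the mean probability to exit from a box
without having seen an active axis is exponentially small. -/
theorem lintegral_prod_mul_stopOp_le (hc1 : c ≤ 1) (hν' : ν.restrict (inactive i) ≤ c • ν')
    (hB : ∀ x, rad z x < n → x ∈ B) (k : ℕ) (x₀ : Site d) (V : Finset (Site d)) (hVB : V ⊆ B)
    (hV : ∀ m < rad z x₀, ∃ y ∈ V, rad z y = m)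
    (g : Site d → LocalLaw d → ℝ≥0∞) (hg : ∀ x, Measurable (g x))
    (hgV : ∀ x ∈ V, ∀ l ∉ inactive i, g x l = 0) (hg1 : ∀ x ∉ V, g x = 1) :
    ∫⁻ ω, (∏ x ∈ B, g x (ω x)) *
      ENNReal.ofReal ((stopOp ω N z n i ^ k) (outside z n) x₀) ∂envLaw ν ≤
      c ^ n * ∏ x ∈ B, ∫⁻ l, g x l ∂ν' := by
  induction k generalizing x₀ V g with
  | zero =>
    by_cases h : n ≤ rad z x₀
    · simp only [pow_zero, Module.End.one_apply, outside, if_pos h, ENNReal.ofReal_one, mul_one]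
      exact lintegral_prod_le hc1 hν' hVB
        (card_ge_of_rad fun m hm => hV m (hm.trans_le h)) hg hgV hg1
    · simp [outside, if_neg h]
  | succ k ih =>
    by_cases h : n ≤ rad z x₀
    · have h1 : ∀ k (ω : Env d), (stopOp ω N z n i ^ k) (outside z n) x₀ = 1 := by
        intro k ω
        induction k with
        | zero => simp [outside, h]
        | succ k ihk =>
          rw [pow_succ', Module.End.mul_apply, stopOp_of_stopped (Or.inl h), ihk]
      simp only [h1, ENNReal.ofReal_one, mul_one]
      exact lintegral_prod_le hc1 hν' hVB
        (card_ge_of_rad fun m hm => hV m (hm.trans_le h)) hg hgV hg1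
    · have hx₀ : x₀ ∈ B := hB x₀ (not_le.1 h)
      -- The weight at a site accumulates the jump probabilities of all visits to it. Revisits
      -- multiply the same factor, so no independence between visits is needed, and distinct sites
      -- remain independent.
      set G : Dir d → Site d → LocalLaw d → ℝ≥0∞ := fun e => Function.update g x₀ fun l =>
        (g x₀ l * (inactive i).indicator 1 l) * ENNReal.ofReal (l.1 e) with hG
      have hGm : ∀ e x, Measurable (G e x) := by
        intro e x
        by_cases hx : x = x₀
        · subst hx
          simp only [hG, Function.update_self]
          exact ((hg x).mul (measurable_one.indicator (measurableSet_inactive i))).mul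
            (measurable_localLaw_apply e).ennreal_ofReal
        · simp only [hG, Function.update_of_ne hx]; exact hg x
      have hprod : ∀ (e : Dir d) (ω : Env d), ∏ x ∈ B, G e x (ω x) = (∏ x ∈ B, g x (ω x)) *
          ((inactive i).indicator 1 (ω x₀) * ENNReal.ofReal (ω.prob x₀ e)) := by
        intro e ω
        rw [← Finset.mul_prod_erase _ _ hx₀,
          ← Finset.mul_prod_erase _ (fun x => g x (ω x)) hx₀]
        have : ∏ x ∈ B.erase x₀, G e x (ω x) = ∏ x ∈ B.erase x₀, g x (ω x) :=
          Finset.prod_congr rfl fun x hx => by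
            simp only [hG, Function.update_of_ne (Finset.ne_of_mem_erase hx)]
        rw [this]
        simp only [hG, Function.update_self, Env.prob]
        ring
      have hstep : ∀ ω : Env d, (∏ x ∈ B, g x (ω x)) *
          ENNReal.ofReal ((stopOp ω N z n i ^ (k + 1)) (outside z n) x₀) =
          ∑ e, (∏ x ∈ B, G e x (ω x)) *
            ENNReal.ofReal ((stopOp ω N z n i ^ k) (outside z n) (refl N x₀ e)) := by
        intro ω
        have hnn : ∀ x, 0 ≤ (stopOp ω N z n i ^ k) (outside z n) x := by
          intro x
          have h := stopOp_pow_mono (ω := ω) (N := N) (z := z) (n := n) (i := i) (D := Set.univ)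
            (fun _ _ _ _ _ => trivial) k (f := fun _ => 0) (g := outside z n)
            (fun y _ => by unfold outside; split_ifs <;> norm_num) x trivial
          rwa [stopOp_pow_const] at h
        simp only [hprod]
        by_cases hs : ω x₀ ∈ inactive i
        · have hns : ¬ Stopped ω z n i x₀ := by rw [stopped_iff]; tauto
          rw [pow_succ', Module.End.mul_apply, stopOp_of_not_stopped hns,
            ENNReal.ofReal_sum_of_nonneg fun e _ => mul_nonneg (prob_nonneg _ _ _) (hnn _),
            Finset.mul_sum]
          refine Finset.sum_congr rfl fun e _ => ?_
          rw [Set.indicator_of_mem hs, ENNReal.ofReal_mul (prob_nonneg _ _ _)]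
          simp only [Pi.one_apply]
          ring
        -- At an active site inside the box the walk is frozen and never counts as outside, so this
        -- case contributes nothing.
        · have h1 : ∀ k, (stopOp ω N z n i ^ k) (outside z n) x₀ = 0 := by
            intro k
            induction k with
            | zero => simp [outside, h]
            | succ k ihk =>
              rw [pow_succ', Module.End.mul_apply,
                stopOp_of_stopped ((stopped_iff _ _ _ _ _).2 (Or.inr hs)), ihk]
          rw [h1, Set.indicator_of_notMem hs]
          simp
      simp only [hstep]
      rw [lintegral_finsetSum]
      · calc ∑ e, ∫⁻ ω, (∏ x ∈ B, G e x (ω x)) *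
            ENNReal.ofReal ((stopOp ω N z n i ^ k) (outside z n) (refl N x₀ e)) ∂envLaw ν
            ≤ ∑ e, c ^ n * ∏ x ∈ B, ∫⁻ l, G e x l ∂ν' := by
              refine Finset.sum_le_sum fun e _ => ?_
              refine ih (refl N x₀ e) (insert x₀ V) ?_ ?_ (G e) (hGm e) ?_ ?_
              · exact Finset.insert_subset hx₀ hVB
              · intro m hm
                have hm' : m < rad z x₀ + 1 := hm.trans_le (rad_refl_le N z x₀ e)
                rcases Nat.lt_succ_iff_lt_or_eq.1 hm' with h1 | h1
                · obtain ⟨y, hy, hym⟩ := hV m h1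
                  exact ⟨y, Finset.mem_insert_of_mem hy, hym⟩
                · exact ⟨x₀, Finset.mem_insert_self _ _, h1.symm⟩
              · intro x hx l hl
                by_cases hxx : x = x₀
                · subst hxx
                  simp [hG, Set.indicator_of_notMem hl]
                · simp only [hG, Function.update_of_ne hxx]
                  exact hgV x ((Finset.mem_insert.1 hx).resolve_left hxx) l hl
              · intro x hx
                rw [Finset.mem_insert, not_or] at hx
                simp only [hG, Function.update_of_ne hx.1]
                exact hg1 x hx.2
          _ = c ^ n * ((∑ e, ∫⁻ l, G e x₀ l ∂ν') * ∏ x ∈ B.erase x₀, ∫⁻ l, g x l ∂ν') := by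
              rw [← Finset.mul_sum, Finset.sum_mul]
              congr 1
              refine Finset.sum_congr rfl fun e _ => ?_
              rw [← Finset.mul_prod_erase _ _ hx₀]
              congr 1
              refine Finset.prod_congr rfl fun x hx => ?_
              simp only [hG, Function.update_of_ne (Finset.ne_of_mem_erase hx)]
          -- The jump probabilities sum to one, so summing over e returns the previous weight times
          -- an indicator. The bound therefore does not deteriorate with the number of steps.
          _ ≤ c ^ n * ((∫⁻ l, g x₀ l ∂ν') * ∏ x ∈ B.erase x₀, ∫⁻ l, g x l ∂ν') := by
              gcongr
              rw [← lintegral_finsetSum _ fun e _ => hGm e x₀]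
              refine lintegral_mono fun l => ?_
              simp only [hG, Function.update_self]
              rw [← Finset.mul_sum]
              have : ∑ e, ENNReal.ofReal (l.1 e) = 1 := by
                rw [← ENNReal.ofReal_sum_of_nonneg fun e _ => l.2.1 e, l.2.2, ENNReal.ofReal_one]
              rw [this, mul_one]
              by_cases hl : l ∈ inactive i <;> simp [hl]
          _ = c ^ n * ∏ x ∈ B, ∫⁻ l, g x l ∂ν' := by
              rw [Finset.mul_prod_erase _ (fun x => ∫⁻ l, g x l ∂ν') hx₀]
      · intro e _
        refine Measurable.mul ?_ (measurable_stopOp_pow _ _ _ _ _ _ _).ennreal_ofReal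
        exact Finset.measurable_fun_prod _ fun x _ => (hGm e x).comp (measurable_pi_apply x)

end Annealed

theorem finite_rad_lt (z : Site d) (n : ℕ) : {x : Site d | rad z x < n}.Finite := by
  refine (Finset.finite_toSet (Fintype.piFinset fun j => Finset.Icc (z j - n) (z j + n))).subset ?_
  intro x hx
  simp only [Finset.mem_coe, Fintype.mem_piFinset, Finset.mem_Icc]
  intro j
  have := abs_le.1 (rad_le_iff.1 (le_of_lt hx) j)
  omega

theorem measurableSet_bad (N n : ℕ) (z : Site d) : MeasurableSet {ω : Env d | Bad ω N n z} := by
  simp only [Bad, Set.ofPred_exists]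
  exact MeasurableSet.iUnion fun i =>
    measurableSet_lt measurable_const (measurable_stopOp_pow _ _ _ _ _ _ _)

/-- Bad boxes are exponentially rare. -/
theorem measure_bad_le (ν : Measure (LocalLaw d)) [IsProbabilityMeasure ν] {c : ℝ≥0∞}
    (hc1 : c ≤ 1) (hc : ∀ i, ν (inactive i) ≤ c) (N n : ℕ) (z : Site d) :
    envLaw ν {ω | Bad ω N n z} ≤ 4 * d * c ^ n := by
  have h : ∀ i, envLaw ν {ω | 1 / 4 < (stopOp ω N z n i ^ (32 * d * n ^ 2)) (outside z n) z} ≤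
      4 * c ^ n := by
    intro i
    obtain ⟨ν', hp, hν'⟩ := exists_conditioned ν i (hc i)
    -- The exploration starts with no visited site and weight one, giving mean exit probability at
    -- most c^n. Markov's inequality at level 1/4 costs the factor 4, and the union over the axes
    -- the factor d.
    have h1 := lintegral_prod_mul_stopOp_le (N := N) (B := (finite_rad_lt z n).toFinset) hc1 hν'
      (fun x hx => by simpa using hx) (32 * d * n ^ 2) z ∅ (by simp) (by simp) (fun _ => 1)
      (fun _ => measurable_one) (by simp) (by simp)
    simp only [Pi.one_apply, Finset.prod_const_one, one_mul, lintegral_one, measure_univ,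
      mul_one] at h1
    have h2 := mul_meas_ge_le_lintegral₀ (μ := envLaw ν) (measurable_stopOp_pow (outside z n) N z n
      i (32 * d * n ^ 2) z).ennreal_ofReal.aemeasurable (ENNReal.ofReal (1 / 4))
    have h3 : ENNReal.ofReal (1 / 4) *
        envLaw ν {ω | 1 / 4 < (stopOp ω N z n i ^ (32 * d * n ^ 2)) (outside z n) z} ≤ c ^ n :=
      le_trans (mul_le_mul_right (measure_mono fun ω hω => ENNReal.ofReal_le_ofReal
        (le_of_lt hω)) _) (h2.trans h1)
    calc envLaw ν {ω | 1 / 4 < (stopOp ω N z n i ^ (32 * d * n ^ 2)) (outside z n) z}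
        = 4 * (ENNReal.ofReal (1 / 4) *
        envLaw ν {ω | 1 / 4 < (stopOp ω N z n i ^ (32 * d * n ^ 2)) (outside z n) z}) := by
          rw [← mul_assoc]
          have : (4 : ℝ≥0∞) * ENNReal.ofReal (1 / 4) = 1 := by
            rw [show (4 : ℝ≥0∞) = ENNReal.ofReal 4 by norm_num, ← ENNReal.ofReal_mul (by norm_num)]
            norm_num
          rw [this, one_mul]
      _ ≤ 4 * c ^ n := by gcongr
  calc envLaw ν {ω | Bad ω N n z} ≤ ∑ i : Fin d,
        envLaw ν {ω | 1 / 4 < (stopOp ω N z n i ^ (32 * d * n ^ 2)) (outside z n) z} := by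
        simp only [Bad, Set.ofPred_exists]
        exact measure_iUnion_fintype_le _ _
    _ ≤ ∑ i : Fin d, 4 * c ^ n := Finset.sum_le_sum fun i _ => h i
    _ = 4 * d * c ^ n := by simp; ring

/-- In dimension one there are no bad boxes. -/
theorem not_bad_of_dim_one {ω : Env 1} (hω : Balanced ω) (N : ℕ) {n : ℕ} (hn : 0 < n)
    (z : Site 1) : ¬ Bad ω N n z := by
  rintro ⟨i, hi⟩
  have hs : Stopped ω z n i z := by
    right
    have := sum_axis_prob hω z
    rw [Fin.sum_univ_one] at this
    rw [Subsingleton.elim i 0, this]; norm_num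
  have h1 : ∀ k, (stopOp ω N z n i ^ k) (outside z n) z = 0 := by
    intro k
    induction k with
    | zero => simp [outside, hn.ne']
    | succ k ihk => rw [pow_succ', Module.End.mul_apply, stopOp_of_stopped hs, ihk]
  rw [h1] at hi
  norm_num at hi

/-! ### Finite-range dependence and fluctuations of the number of bad boxes -/

theorem stopOp_pow_congr {ω ω' : Env d} {N n : ℕ} {z : Site d} {i : Fin d}
    (h : ∀ x, rad z x < n → ω x = ω' x) (f : Site d → ℝ) (k : ℕ) (x : Site d) :
    (stopOp ω N z n i ^ k) f x = (stopOp ω' N z n i ^ k) f x := by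
  induction k generalizing x with
  | zero => rfl
  | succ k ih =>
    rw [pow_succ', pow_succ', Module.End.mul_apply, Module.End.mul_apply]
    by_cases hx : n ≤ rad z x
    · rw [stopOp_of_stopped (Or.inl hx), stopOp_of_stopped (Or.inl hx), ih]
    · have hxx := h x (not_le.1 hx)
      have hs : Stopped ω z n i x ↔ Stopped ω' z n i x := by
        rw [stopped_iff, stopped_iff, hxx]
      by_cases h1 : Stopped ω z n i x
      · rw [stopOp_of_stopped h1, stopOp_of_stopped (hs.1 h1), ih]
      · rw [stopOp_of_not_stopped h1, stopOp_of_not_stopped (fun h => h1 (hs.2 h))]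
        simp only [ih, Env.prob, hxx]

theorem bad_congr {ω ω' : Env d} {N n : ℕ} {z : Site d}
    (h : ∀ x, rad z x < n → ω x = ω' x) : Bad ω N n z ↔ Bad ω' N n z := by
  simp only [Bad, stopOp_pow_congr h]

/-- The event `A` depends only on the environment in `S`. -/
def DependsOnSites (S : Finset (Site d)) (A : Set (Env d)) : Prop :=
  ∀ ω ω' : Env d, (∀ x ∈ S, ω x = ω' x) → (ω ∈ A ↔ ω' ∈ A)

/-- Events depending on disjoint sets of sites are independent. -/
theorem envLaw_inter {ν : Measure (LocalLaw d)} [IsProbabilityMeasure ν] {S T : Finset (Site d)}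
    (hST : Disjoint S T) {A B : Set (Env d)} (hA : MeasurableSet A) (hB : MeasurableSet B)
    (hAS : DependsOnSites S A) (hBT : DependsOnSites T B) :
    envLaw ν (A ∩ B) = envLaw ν A * envLaw ν B := by
  classical
  have hind := (iIndepFun_infinitePi (P := fun _ : Site d => ν) (X := fun _ l => l)
    (fun _ => measurable_id)).indepFun_finset S T hST (fun x => measurable_pi_apply x)
  obtain ⟨ω₀⟩ : Nonempty (Env d) := (envLaw ν).nonempty_of_neZero
  -- Filling in a fixed environment outside U exhibits E as an event of the coordinates in U.
  have key : ∀ (U : Finset (Site d)) (E : Set (Env d)), DependsOnSites U E →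
      E = (fun (ω : Env d) (x : U) => ω x) ⁻¹' (Function.updateFinset ω₀ U ⁻¹' E) := by
    intro U E hE
    ext ω
    exact hE _ _ fun x hx => by simp [Function.updateFinset, hx]
  rw [key S A hAS, key T B hBT]
  exact hind.measure_inter_preimage_eq_mul _ _ (measurable_updateFinset hA)
    (measurable_updateFinset hB)

theorem dependsOnSites_bad (N n : ℕ) (z : Site d) :
    DependsOnSites (finite_rad_lt z n).toFinset {ω | Bad ω N n z} :=
  fun _ _ h => bad_congr fun x hx => h x (by simpa using hx)

open Classical in
/-- The number of bad boxes of radius `n` in the cube. -/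
noncomputable def badCount (N n : ℕ) (ω : Env d) : ℝ :=
  ∑ z ∈ cubeFinset d N, if Bad ω N n z then 1 else 0

theorem badCount_eq (N n : ℕ) : badCount (d := d) N n =
    fun ω => ∑ z ∈ cubeFinset d N, ({ω | Bad ω N n z}.indicator 1 ω : ℝ) := by
  ext ω
  refine Finset.sum_congr rfl fun z _ => ?_
  by_cases h : Bad ω N n z <;> simp [Set.indicator, h]

theorem sum_slopeBound (ω : Env d) (N : ℕ) : ∑ z ∈ cubeFinset d N, slopeBound ω N z =
    (N : ℝ) ^ d * slopeWeight d 1 +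
      ∑ n ∈ Finset.Ico 1 (N / 16), slopeWeight d (n + 1) * badCount N n ω := by
  simp only [slopeBound, badCount, Finset.sum_add_distrib, Finset.sum_const, card_cubeFinset]
  rw [Finset.sum_comm, nsmul_eq_mul]
  simp only [Finset.mul_sum]
  push_cast
  rfl

theorem memLp_indicator_one {Ω : Type*} [MeasurableSpace Ω] (P : Measure Ω)
    [IsProbabilityMeasure P] {A : Set Ω} (hA : MeasurableSet A) :
    MemLp (A.indicator (1 : Ω → ℝ)) 2 P :=
  (memLp_const (1 : ℝ)).indicator hA

theorem covariance_indicator {Ω : Type*} [MeasurableSpace Ω] (P : Measure Ω)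
    [IsProbabilityMeasure P] {A B : Set Ω} (hA : MeasurableSet A) (hB : MeasurableSet B) :
    cov[A.indicator (1 : Ω → ℝ), B.indicator 1; P] = P.real (A ∩ B) - P.real A * P.real B := by
  rw [covariance_eq_sub (memLp_indicator_one P hA) (memLp_indicator_one P hB), ← Set.inter_indicator_one,
    integral_indicator_one hA, integral_indicator_one hB, integral_indicator_one (hA.inter hB)]

section Moments

variable {ν : Measure (LocalLaw d)} [IsProbabilityMeasure ν] {q : ℝ} {N n : ℕ}

theorem card_rad_lt_le (z : Site d) (m : ℕ) :
    (finite_rad_lt z m).toFinset.card ≤ (2 * m + 1) ^ d := by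
  calc _ ≤ (Fintype.piFinset fun j => Finset.Icc (z j - m) (z j + m)).card := by
        refine Finset.card_le_card fun x hx => ?_
        simp only [Fintype.mem_piFinset, Finset.mem_Icc]
        intro j
        have := abs_le.1 (rad_le_iff.1 (le_of_lt (by simpa using hx)) j)
        omega
    _ = (2 * m + 1) ^ d := by
        rw [Fintype.card_piFinset]
        simp only [Int.card_Icc]
        have : ∀ j, (z j + m + 1 - (z j - m)).toNat = 2 * m + 1 := fun j => by omega
        simp [this]

/-- Balls of radius n around sites at distance at least 2n are disjoint, so the corresponding events
are uncorrelated. Each site has at most (4n + 1)^d others to be correlated with, and each covariance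
is at most q. -/
theorem variance_badCount_le (hq : ∀ z, (envLaw ν).real {ω | Bad ω N n z} ≤ q) :
    Var[badCount N n; envLaw ν] ≤ (N : ℝ) ^ d * ((4 * n + 1) ^ d * q) := by
  classical
  have hq0 : 0 ≤ q := measureReal_nonneg.trans (hq 0)
  rw [badCount_eq, variance_fun_sum' fun z _ =>
    memLp_indicator_one _ (measurableSet_bad N n z)]
  calc _ ≤ ∑ z ∈ cubeFinset d N, ∑ w ∈ (finite_rad_lt z (2 * n)).toFinset, q := by
        refine Finset.sum_le_sum fun z _ => ?_
        have hcov : ∀ w, cov[{ω | Bad ω N n z}.indicator (1 : Env d → ℝ),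
            {ω | Bad ω N n w}.indicator 1; envLaw ν] ≤
            if w ∈ (finite_rad_lt z (2 * n)).toFinset then q else 0 := by
          intro w
          rw [covariance_indicator _ (measurableSet_bad N n z) (measurableSet_bad N n w)]
          split_ifs with hw
          · have h1 : (envLaw ν).real ({ω | Bad ω N n z} ∩ {ω | Bad ω N n w}) ≤ q :=
              (measureReal_mono Set.inter_subset_left).trans (hq z)
            have h2 : 0 ≤ (envLaw ν).real {ω | Bad ω N n z} *
              (envLaw ν).real {ω | Bad ω N n w} := by positivity
            linarith
          · have hdis : Disjoint (finite_rad_lt z n).toFinset (finite_rad_lt w n).toFinset := by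
              rw [Finset.disjoint_left]
              intro x hxz hxw
              simp only [Set.Finite.mem_toFinset, Set.mem_ofPred_eq] at hxz hxw hw
              have hn : 0 < n := by omega
              refine hw ((rad_lt_iff (by omega)).2 fun j => ?_)
              have h1 := abs_lt.1 ((rad_lt_iff hn).1 hxz j)
              have h2 := abs_lt.1 ((rad_lt_iff hn).1 hxw j)
              rw [abs_lt]; push_cast; constructor <;> linarith [h1.1, h1.2, h2.1, h2.2]
            have := envLaw_inter (ν := ν) hdis (measurableSet_bad N n z) (measurableSet_bad N n w)
              (dependsOnSites_bad N n z) (dependsOnSites_bad N n w)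
            simp [Measure.real, this, ENNReal.toReal_mul]
        calc _ ≤ ∑ w ∈ cubeFinset d N,
              if w ∈ (finite_rad_lt z (2 * n)).toFinset then q else 0 :=
              Finset.sum_le_sum fun w _ => hcov w
          _ ≤ _ := by
              rw [← Finset.sum_filter]
              refine Finset.sum_le_sum_of_subset_of_nonneg ?_ fun _ _ _ => hq0
              intro w hw
              exact (Finset.mem_filter.1 hw).2
    _ ≤ ∑ z ∈ cubeFinset d N, ((4 * n + 1) ^ d * q) := by
        refine Finset.sum_le_sum fun z _ => ?_
        rw [Finset.sum_const, nsmul_eq_mul]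
        refine mul_le_mul_of_nonneg_right ?_ hq0
        have := card_rad_lt_le z (2 * n)
        calc ((finite_rad_lt z (2 * n)).toFinset.card : ℝ) ≤ ((2 * (2 * n) + 1) ^ d : ℕ) := by
              exact_mod_cast this
          _ = (4 * n + 1) ^ d := by push_cast; ring
    _ = _ := by simp [card_cubeFinset]

/-- Chebyshev's inequality for a deviation of b N^d from a mean that is at most q N^d. -/
theorem measure_badCount_ge_le (hN : 0 < N) (hq : ∀ z, (envLaw ν).real {ω | Bad ω N n z} ≤ q)
    {b : ℝ} (hb : 0 < b) :
    envLaw ν {ω : Env d | (q + b) * (N : ℝ) ^ d ≤ badCount N n ω} ≤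
      ENNReal.ofReal ((4 * n + 1) ^ d * q / b ^ 2 / (N : ℝ) ^ d) := by
  have hNd : (0 : ℝ) < (N : ℝ) ^ d := by positivity
  have hmem : MemLp (badCount (d := d) N n) 2 (envLaw ν) := by
    rw [badCount_eq]
    exact memLp_finsetSum _ fun z _ => memLp_indicator_one _ (measurableSet_bad N n z)
  have hE : (envLaw ν)[badCount (d := d) N n] ≤ q * (N : ℝ) ^ d := by
    rw [badCount_eq, integral_finsetSum _ fun z _ =>
      (memLp_indicator_one _ (measurableSet_bad N n z)).integrable (by norm_num)]
    calc _ ≤ ∑ z ∈ cubeFinset d N, q := by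
          refine Finset.sum_le_sum fun z _ => ?_
          have := integral_indicator_one (μ := envLaw ν) (measurableSet_bad N n z)
          exact this.le.trans (hq z)
      _ = _ := by simp [card_cubeFinset, mul_comm]
  have h := meas_ge_le_variance_div_sq hmem (c := b * (N : ℝ) ^ d) (by positivity)
  refine le_trans (measure_mono fun ω hω => ?_) (h.trans (ENNReal.ofReal_le_ofReal ?_))
  · simp only [Set.mem_ofPred_eq] at hω ⊢
    refine le_trans ?_ (le_abs_self _)
    linarith
  · rw [div_le_iff₀ (by positivity)]
    refine (variance_badCount_le hq).trans (le_of_eq ?_)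
    field_simp

end Moments

/-! ### Almost sure control at all scales, by Borel–Cantelli -/

theorem summable_pow_mul_geometric {r : ℝ} (h0 : 0 < r) (h1 : r < 1) (k : ℕ) :
    Summable fun n : ℕ => ((n : ℝ) + 1) ^ k * r ^ n := by
  have h := summable_pow_mul_geometric_of_norm_lt_one k
    (show ‖r‖ < 1 by rwa [Real.norm_of_nonneg h0.le])
  have h2 := ((summable_nat_add_iff 1).2 h).mul_left r⁻¹
  refine h2.congr fun n => ?_
  push_cast
  rw [pow_succ r n]
  field_simp

theorem slopeWeight_succ_le (d n : ℕ) :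
    slopeWeight d (n + 1) ≤ (4 * d + 3 : ℝ) ^ (2 * d) * ((n : ℝ) + 1) ^ (4 * d) := by
  have : (4 * d * ((n + 1 : ℕ) : ℝ) ^ 2 + 3 : ℝ) ≤ (4 * d + 3) * ((n : ℝ) + 1) ^ 2 := by
    push_cast
    nlinarith [show (0 : ℝ) ≤ n by positivity]
  calc slopeWeight d (n + 1) = (4 * d * ((n + 1 : ℕ) : ℝ) ^ 2 + 3 : ℝ) ^ (2 * d) := by
        unfold slopeWeight; rw [← pow_mul, mul_comm d 2]
    _ ≤ ((4 * d + 3) * ((n : ℝ) + 1) ^ 2) ^ (2 * d) := pow_le_pow_left₀ (by positivity) this _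
    _ = _ := by rw [mul_pow, ← pow_mul]; ring_nf

theorem ae_eventually_of_summable {Ω : Type*} [MeasurableSpace Ω] {P : Measure Ω}
    {s : ℕ → Set Ω} {a : ℕ → ℝ} (ha : Summable a) (ha0 : ∀ n, 0 ≤ a n)
    (h : ∀ᶠ n in atTop, P (s n) ≤ ENNReal.ofReal (a n)) : ∀ᵐ ω ∂P, ∀ᶠ n in atTop, ω ∉ s n := by
  obtain ⟨n₀, hn₀⟩ := eventually_atTop.1 h
  have h1 : ∑' n, P (s (n + n₀)) ≠ ∞ := by
    have h2 : Summable fun n => a (n + n₀) := (summable_nat_add_iff n₀).2 ha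
    have h3 : ∑' n, ENNReal.ofReal (a (n + n₀)) ≠ ∞ := by
      rw [← ENNReal.ofReal_tsum_of_nonneg (fun n => ha0 _) h2]; exact ENNReal.ofReal_ne_top
    exact ne_top_of_le_ne_top h3 (ENNReal.tsum_le_tsum fun n => hn₀ _ (by omega))
  filter_upwards [ae_eventually_notMem h1] with ω hω
  exact (eventually_atTop.2 (by
    obtain ⟨m, hm⟩ := eventually_atTop.1 hω
    exact ⟨m + n₀, fun n hn => by
      have := hm (n - n₀) (by omega)
      rwa [Nat.sub_add_cancel (by omega)] at this⟩))

section

variable {ν : Measure (LocalLaw d)} [IsProbabilityMeasure ν] {ρ : ℝ}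

theorem exists_rate (hact : ∀ i, ν (inactive i) < 1) :
    ∃ ρ : ℝ, 0 < ρ ∧ ρ < 1 ∧ ∀ N n z,
      (envLaw ν).real {ω : Env d | Bad ω N n z} ≤ 4 * d * ρ ^ (16 * n) := by
  set c : ℝ≥0∞ := Finset.univ.sup fun i => ν (inactive i) with hc
  have hc1 : c < 1 := (Finset.sup_lt_iff (by simp)).2 fun i _ => hact i
  have hct : c ≠ ∞ := (hc1.trans ENNReal.one_lt_top).ne
  have hc0 : 0 ≤ c.toReal := ENNReal.toReal_nonneg
  have hcr : c.toReal < 1 := by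
    rw [← ENNReal.toReal_one]; exact (ENNReal.toReal_lt_toReal hct ENNReal.one_ne_top).2 hc1
  -- By Bernoulli's inequality the 16th power of this number is at least c. The exponent 16n makes
  -- the rate comparable to ρ^N at the scale N/16.
  refine ⟨1 - (1 - c.toReal) / 16, by linarith, by linarith, fun N n z => ?_⟩
  have h1 : c.toReal ≤ (1 - (1 - c.toReal) / 16) ^ 16 := by
    have := one_add_mul_le_pow (show -2 ≤ -((1 - c.toReal) / 16) by linarith) 16
    push_cast at this
    rw [← sub_eq_add_neg] at this
    refine le_trans (le_of_eq ?_) this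
    ring
  have h2 := measure_bad_le ν hc1.le (fun i => Finset.le_sup (f := fun i => ν (inactive i))
    (Finset.mem_univ i)) N n z
  have h3 := ENNReal.toReal_mono (by finiteness) h2
  simp only [ENNReal.toReal_mul, ENNReal.toReal_pow, ENNReal.toReal_natCast,
    ENNReal.toReal_ofNat] at h3
  refine h3.trans ?_
  rw [pow_mul]
  gcongr

theorem ae_eventually_not_bad (h0 : 0 < ρ) (h1 : ρ < 1)
    (hρ : ∀ N n z, (envLaw ν).real {ω : Env d | Bad ω N n z} ≤ 4 * d * ρ ^ (16 * n)) :
    ∀ᵐ ω ∂envLaw ν, ∀ᶠ N : ℕ in atTop, ∀ z ∈ cube d N, ¬ Bad ω N (N / 16) z := by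
  have hs : Summable fun N : ℕ => 4 * d / ρ ^ 16 * (((N : ℝ) + 1) ^ d * ρ ^ N) :=
    (summable_pow_mul_geometric h0 h1 d).mul_left _
  have h := ae_eventually_of_summable (P := envLaw ν)
    (s := fun N => ⋃ z ∈ cubeFinset d N, {ω : Env d | Bad ω N (N / 16) z}) hs
    (fun N => by positivity) (Eventually.of_forall fun N => ?_)
  · filter_upwards [h] with ω hω
    filter_upwards [hω] with N hN z hz hb
    exact hN (Set.mem_biUnion (mem_cubeFinset.2 hz) hb)
  · refine (measure_biUnion_finset_le _ _).trans ?_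
    calc ∑ z ∈ cubeFinset d N, envLaw ν {ω : Env d | Bad ω N (N / 16) z}
        ≤ ∑ z ∈ cubeFinset d N, ENNReal.ofReal (4 * d * ρ ^ (16 * (N / 16))) := by
          refine Finset.sum_le_sum fun z _ => ?_
          exact (ENNReal.le_ofReal_iff_toReal_le (measure_ne_top _ _) (by positivity)).2 (hρ _ _ _)
      _ = ENNReal.ofReal ((N : ℝ) ^ d * (4 * d * ρ ^ (16 * (N / 16)))) := by
          rw [Finset.sum_const, card_cubeFinset, nsmul_eq_mul,
            ENNReal.ofReal_mul (p := (N : ℝ) ^ d) (by positivity)]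
          rw [← Nat.cast_pow, ENNReal.ofReal_natCast]
      _ ≤ _ := by
          refine ENNReal.ofReal_le_ofReal ?_
          -- The integer division loses less than 16 in the exponent, so the union over N^d centres
          -- is still summable in N.
          have h2 : ρ ^ (16 * (N / 16)) ≤ ρ ^ N / ρ ^ 16 := by
            rw [le_div_iff₀ (by positivity), ← pow_add]
            exact pow_le_pow_of_le_one h0.le h1.le (by omega)
          have h3 : (N : ℝ) ^ d ≤ ((N : ℝ) + 1) ^ d :=
            pow_le_pow_left₀ (by positivity) (by linarith) d
          calc (N : ℝ) ^ d * (4 * d * ρ ^ (16 * (N / 16)))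
              ≤ ((N : ℝ) + 1) ^ d * (4 * d * (ρ ^ N / ρ ^ 16)) := by gcongr
            _ = _ := by ring

/-- With deviation b = ρ^(4n) and q = 4dρ^(16n) the ratio q/b^2 = 4dρ^(8n) beats the polynomial
factor, so the Chebyshev bounds are summable over n. The remaining factor N^{-d} is summable over N
because d ≥ 2. -/
theorem ae_eventually_badCount_lt (hd : 2 ≤ d) (h0 : 0 < ρ) (h1 : ρ < 1)
    (hρ : ∀ N n z, (envLaw ν).real {ω : Env d | Bad ω N n z} ≤ 4 * d * ρ ^ (16 * n)) :
    ∀ᵐ ω ∂envLaw ν, ∀ᶠ N : ℕ in atTop, ∀ n ∈ Finset.Ico 1 (N / 16),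
      badCount N n ω < (4 * d * ρ ^ (16 * n) + ρ ^ (4 * n)) * (N : ℝ) ^ d := by
  set s : ℕ → ℝ := fun n => (4 * n + 1) ^ d * (4 * d * ρ ^ (16 * n)) / (ρ ^ (4 * n)) ^ 2 with hs
  have hs0 : ∀ n, 0 ≤ s n := fun n => by positivity
  have hsum : Summable s := by
    refine Summable.of_nonneg_of_le hs0 (fun n => ?_)
      ((summable_pow_mul_geometric h0 h1 d).mul_left (4 ^ d * (4 * d) : ℝ))
    have h2 : s n = (4 * n + 1) ^ d * (4 * d) * ρ ^ (8 * n) := by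
      rw [hs]; dsimp only
      rw [div_eq_iff (by positivity)]; ring
    have h3 : (4 * n + 1 : ℝ) ^ d ≤ 4 ^ d * ((n : ℝ) + 1) ^ d := by
      rw [← mul_pow]; exact pow_le_pow_left₀ (by positivity) (by linarith) d
    rw [h2]
    calc (4 * n + 1 : ℝ) ^ d * (4 * d) * ρ ^ (8 * n)
        ≤ 4 ^ d * ((n : ℝ) + 1) ^ d * (4 * d) * ρ ^ n := by
          gcongr ?_ * _ * ?_
          exact pow_le_pow_of_le_one h0.le h1.le (by omega)
      _ = _ := by ring
  have hs2 : Summable fun N : ℕ => (∑' n, s n) * ((N : ℝ) ^ 2)⁻¹ :=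
    (Real.summable_nat_pow_inv.2 (by norm_num)).mul_left _
  have hS : 0 ≤ ∑' n, s n := tsum_nonneg hs0
  have h := ae_eventually_of_summable (P := envLaw ν)
    (s := fun N => ⋃ n ∈ Finset.Ico 1 (N / 16), {ω : Env d |
      (4 * d * ρ ^ (16 * n) + ρ ^ (4 * n)) * (N : ℝ) ^ d ≤ badCount N n ω}) hs2
    (fun N => by positivity) ((eventually_gt_atTop 0).mono fun N hN => ?_)
  · filter_upwards [h] with ω hω
    filter_upwards [hω] with N hN n hn
    by_contra hc
    exact hN (Set.mem_biUnion hn (not_lt.1 hc))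
  · refine (measure_biUnion_finset_le _ _).trans ?_
    have hNr : (1 : ℝ) ≤ N := by exact_mod_cast hN
    calc _ ≤ ∑ n ∈ Finset.Ico 1 (N / 16), ENNReal.ofReal (s n / (N : ℝ) ^ d) :=
          Finset.sum_le_sum fun n _ => measure_badCount_ge_le hN (hρ N n) (by positivity)
      _ = ENNReal.ofReal (∑ n ∈ Finset.Ico 1 (N / 16), s n / (N : ℝ) ^ d) :=
          (ENNReal.ofReal_sum_of_nonneg fun n _ => div_nonneg (hs0 n) (by positivity)).symm
      _ ≤ _ := by
          refine ENNReal.ofReal_le_ofReal ?_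
          rw [← Finset.sum_div, div_eq_mul_inv]
          refine mul_le_mul (hsum.sum_le_tsum _ fun n _ => hs0 n) ?_ (by positivity) hS
          exact inv_anti₀ (by positivity) (pow_le_pow_right₀ hNr hd)

/-- For large cubes there are no bad boxes of linear size, and the bounds for the numbers of slopes
are bounded in mean. -/
theorem ae_eventually_slopeBound (hd : 0 < d) (hbal : ∀ᵐ ω ∂envLaw ν, Balanced ω)
    (hact : ∀ i, ν (inactive i) < 1) :
    ∃ B : ℝ, 0 < B ∧ ∀ᵐ ω ∂envLaw ν, ∀ᶠ N : ℕ in atTop,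
      (∀ z ∈ cube d N, ¬ Bad ω N (N / 16) z) ∧
      ∑ z ∈ cubeFinset d N, slopeBound ω N z ≤ B * (N : ℝ) ^ d := by
  obtain ⟨ρ, h0, h1, hρ⟩ := exists_rate hact
  have hw1 : 0 < slopeWeight d 1 := by unfold slopeWeight; positivity
  -- In dimension one the Chebyshev bound 1/N would not be summable, but the only axis is always
  -- active and no box is bad.
  rcases Nat.eq_or_lt_of_le (show 1 ≤ d from hd) with h | hd2
  · subst h
    refine ⟨slopeWeight 1 1, hw1, ?_⟩
    filter_upwards [ae_eventually_not_bad h0 h1 hρ, hbal] with ω hω hb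
    filter_upwards [hω] with N hN
    refine ⟨hN, ?_⟩
    rw [sum_slopeBound, Finset.sum_eq_zero, add_zero, mul_comm]
    intro n hn
    have hn0 : 0 < n := (Finset.mem_Ico.1 hn).1
    simp [badCount, not_bad_of_dim_one hb N hn0]
  · set a : ℕ → ℝ := fun n => slopeWeight d (n + 1) * (4 * d * ρ ^ (16 * n) + ρ ^ (4 * n)) with ha
    have ha0 : ∀ n, 0 ≤ a n := fun n => mul_nonneg (slopeWeight_nonneg _ _) (by positivity)
    have hsum : Summable a := by
      refine Summable.of_nonneg_of_le ha0 (fun n => ?_)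
        ((summable_pow_mul_geometric h0 h1 (4 * d)).mul_left
          ((4 * d + 3 : ℝ) ^ (2 * d) * (4 * d + 1)))
      have h2 : ρ ^ (16 * n) ≤ ρ ^ n := pow_le_pow_of_le_one h0.le h1.le (by omega)
      have h3 : ρ ^ (4 * n) ≤ ρ ^ n := pow_le_pow_of_le_one h0.le h1.le (by omega)
      calc a n ≤ ((4 * d + 3 : ℝ) ^ (2 * d) * ((n : ℝ) + 1) ^ (4 * d)) *
            (4 * d * ρ ^ n + ρ ^ n) :=
            mul_le_mul (slopeWeight_succ_le d n) (by gcongr) (by positivity) (by positivity)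
        _ = _ := by ring
    have hS : 0 ≤ ∑' n, a n := tsum_nonneg ha0
    refine ⟨slopeWeight d 1 + ∑' n, a n, by positivity, ?_⟩
    filter_upwards [ae_eventually_not_bad h0 h1 hρ, ae_eventually_badCount_lt hd2 h0 h1 hρ]
      with ω hω1 hω2
    filter_upwards [hω1, hω2] with N hN1 hN2
    refine ⟨hN1, ?_⟩
    rw [sum_slopeBound, add_mul]
    refine add_le_add (mul_comm _ _).le ?_
    calc ∑ n ∈ Finset.Ico 1 (N / 16), slopeWeight d (n + 1) * badCount N n ω
        ≤ ∑ n ∈ Finset.Ico 1 (N / 16), a n * (N : ℝ) ^ d := by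
          refine Finset.sum_le_sum fun n hn => ?_
          rw [ha]; dsimp only
          rw [mul_assoc]
          exact mul_le_mul_of_nonneg_left (hN2 n hn).le (slopeWeight_nonneg _ _)
      _ ≤ _ := by
          rw [← Finset.sum_mul]
          exact mul_le_mul_of_nonneg_right (hsum.sum_le_tsum _ fun n _ => ha0 n) (by positivity)

/-- Closed sets of the reflected walks have a positive density in large cubes. -/
theorem ae_eventually_card_ge (hd : 0 < d) (hbal : ∀ᵐ ω ∂envLaw ν, Balanced ω)
    (hact : ∀ i, ν (inactive i) < 1) :
    ∃ Φ : ℝ, 0 < Φ ∧ ∀ᵐ ω ∂envLaw ν, ∀ᶠ N : ℕ in atTop, ∀ S : Set (Site d),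
      IsReflClosed ω N S → S.Nonempty → Φ * (N : ℝ) ^ d ≤ S.ncard := by
  obtain ⟨B, hB, h⟩ := ae_eventually_slopeBound hd hbal hact
  refine ⟨(16 ^ d * B)⁻¹, by positivity, ?_⟩
  filter_upwards [h, hbal] with ω hω hb
  filter_upwards [hω, eventually_ge_atTop 16] with N hN h16 S hS hne
  rw [inv_mul_le_iff₀ (by positivity)]
  exact hS.card_ge hb h16 hne hN.1 hN.2

end

/-! ### Stationary measures of the reflected walk and closed sets -/

theorem reflectedKernel_singleton_pos (ω : Env d) (N : ℕ) (x y : Site d) :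
    0 < reflectedKernel ω N x {y} ↔ ∃ e, 0 < ω.prob x e ∧ y = refl N x e :=
  jumpKernel_singleton_pos ω _ x y

/-- The support of a stationary measure of the reflected walk is closed. -/
theorem IsReflectedStationary.isReflClosed {ω : Env d} {N : ℕ} {μ : Measure (Site d)}
    (hμ : IsReflectedStationary ω N μ) : IsReflClosed ω N {z | 0 < μ {z}} := by
  obtain ⟨-, hc, hinv⟩ := hμ
  constructor
  · intro z hz
    by_contra hzc
    exact (ne_of_gt hz) (measure_mono_null (by simpa using hzc) hc)
  · intro x hx e he
    have h1 : 0 < reflectedKernel ω N x {refl N x e} :=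
      (reflectedKernel_singleton_pos _ _ _ _).2 ⟨e, he, rfl⟩
    have h2 : μ {refl N x e} = ∫⁻ z, reflectedKernel ω N z {refl N x e} ∂μ := by
      conv_lhs => rw [← hinv.def]
      exact Measure.bind_apply (MeasurableSet.singleton _) (Kernel.aemeasurable _)
    change 0 < μ {refl N x e}
    rw [h2]
    calc 0 < reflectedKernel ω N x {refl N x e} * μ {x} := ENNReal.mul_pos h1.ne' (ne_of_gt hx)
      _ = ∫⁻ z in {x}, reflectedKernel ω N z {refl N x e} ∂μ := by
        rw [lintegral_singleton]
      _ ≤ _ := setLIntegral_le_lintegral _ _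

theorem IsReflectedStationary.nonempty {ω : Env d} {N : ℕ} {μ : Measure (Site d)}
    (hμ : IsReflectedStationary ω N μ) : {z | 0 < μ {z}}.Nonempty := by
  by_contra h
  rw [Set.not_nonempty_iff_eq_empty] at h
  have h0 : ∀ z, μ {z} = 0 := fun z => by
    by_contra hz
    exact (Set.eq_empty_iff_forall_notMem.1 h z) (pos_iff_ne_zero.2 hz)
  have := hμ.1
  have h1 : μ Set.univ = 0 := by
    rw [← Set.biUnion_of_singleton (Set.univ : Set (Site d))]
    exact (measure_biUnion_null_iff (Set.to_countable _)).2 fun z _ => h0 z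
  simp at h1

/-- A stochastic matrix has an invariant probability vector. -/
theorem exists_invariant_vector {ι : Type*} [Fintype ι] [Nonempty ι] (M : ι → ι → ℝ)
    (h0 : ∀ x y, 0 ≤ M x y) (h1 : ∀ x, ∑ y, M x y = 1) :
    ∃ v : ι → ℝ, (∀ x, 0 ≤ v x) ∧ ∑ x, v x = 1 ∧ ∀ y, ∑ x, v x * M x y = v y := by
  classical
  -- The constant vector is a right null vector of M - 1, so there is also a left one.
  have hdet : (Matrix.of M - 1).det = 0 := by
    rw [← Matrix.exists_mulVec_eq_zero_iff]
    refine ⟨fun _ => 1, fun h => one_ne_zero (congrFun h (Classical.arbitrary ι)), ?_⟩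
    rw [Matrix.sub_mulVec, Matrix.one_mulVec]
    ext x
    simp [Matrix.mulVec, dotProduct, h1]
  obtain ⟨v, hv0, hv⟩ := Matrix.exists_vecMul_eq_zero_iff.2 hdet
  rw [Matrix.vecMul_sub, Matrix.vecMul_one, sub_eq_zero] at hv
  have hv' : ∀ y, ∑ x, v x * M x y = v y := fun y => congrFun hv y
  -- Both sides have the same sum over y because M is stochastic, so equality holds for each y, and
  -- |v| can be normalised.
  have hle : ∀ y, |v y| ≤ ∑ x, |v x| * M x y := fun y => by
    calc |v y| = |∑ x, v x * M x y| := by rw [hv']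
      _ ≤ ∑ x, |v x * M x y| := Finset.abs_sum_le_sum_abs _ _
      _ = ∑ x, |v x| * M x y := Finset.sum_congr rfl fun x _ => by
        rw [abs_mul, abs_of_nonneg (h0 x y)]
  have hsum : ∑ y, |v y| = ∑ y, ∑ x, |v x| * M x y := by
    rw [Finset.sum_comm]
    exact Finset.sum_congr rfl fun x _ => by rw [← Finset.mul_sum, h1, mul_one]
  have heq := (Finset.sum_eq_sum_iff_of_le fun y _ => hle y).1 hsum
  have hpos : 0 < ∑ x, |v x| := by
    obtain ⟨x, hx⟩ := Function.ne_iff.1 hv0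
    exact Finset.sum_pos' (fun _ _ => abs_nonneg _) ⟨x, Finset.mem_univ _, abs_pos.2 hx⟩
  refine ⟨fun x => |v x| / ∑ x, |v x|, fun x => by positivity, ?_, fun y => ?_⟩
  · rw [← Finset.sum_div, div_self hpos.ne']
  · dsimp only
    rw [heq y (Finset.mem_univ y), Finset.sum_div]
    exact Finset.sum_congr rfl fun x _ => by ring

/-- Every nonempty closed set of the reflected walk carries a stationary measure. -/
theorem IsReflClosed.exists_stationary {ω : Env d} {N : ℕ} {S : Set (Site d)}
    (hS : IsReflClosed ω N S) (hne : S.Nonempty) :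
    ∃ μ, IsReflectedStationary ω N μ ∧ {z | 0 < μ {z}} ⊆ S := by
  classical
  have := hS.finite.fintype
  have : Nonempty S := hne.to_subtype
  have hsing : ∀ (x y : Site d), reflectedKernel ω N x {y} =
      ENNReal.ofReal (∑ e, ω.prob x e * if refl N x e = y then 1 else 0) := by
    intro x y
    rw [ENNReal.ofReal_sum_of_nonneg fun e _ =>
      mul_nonneg (prob_nonneg _ _ _) (by split_ifs <;> norm_num)]
    refine (jumpKernel_apply ω _ x {y}).trans (Finset.sum_congr rfl fun e _ => ?_)
    rw [ENNReal.ofReal_mul (prob_nonneg _ _ _)]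
    congr 1
    change Set.indicator {y} 1 (refl N x e) = _
    by_cases h : refl N x e = y <;> simp [h]
  obtain ⟨v, hv0, hv1, hv⟩ := exists_invariant_vector
    (fun x y : S => ∑ e, ω.prob x e * if refl N x e = y then (1 : ℝ) else 0)
    (fun x y => Finset.sum_nonneg fun e _ =>
      mul_nonneg (prob_nonneg _ _ _) (by split_ifs <;> norm_num))
    (fun x => by
      rw [Finset.sum_comm]
      refine Eq.trans ?_ (sum_prob ω x)
      refine Finset.sum_congr rfl fun e _ => ?_
      rw [← Finset.mul_sum]
      rcases (prob_nonneg ω x e).eq_or_lt with h0 | h0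
      · simp [← h0]
      · have hmem := hS.closed x x.2 e h0
        rw [Finset.sum_eq_single (⟨_, hmem⟩ : S)]
        · simp
        · intro y _ hy
          exact if_neg fun h => hy (Subtype.ext h.symm)
        · simp)
  set μ : Measure (Site d) := ∑ x : S, ENNReal.ofReal (v x) • Measure.dirac (x : Site d) with hμ
  have hμs : ∀ s : Set (Site d), μ s = ∑ x : S, ENNReal.ofReal (v x) * s.indicator 1 (x : Site d) :=
    fun s => by simp [hμ, Measure.finsetSum_apply]
  have hμS : ∀ s : Set (Site d), (∀ x ∈ S, x ∉ s) → μ s = 0 := fun s hs => by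
    rw [hμs]
    exact Finset.sum_eq_zero fun x _ => by rw [Set.indicator_of_notMem (hs x x.2), mul_zero]
  refine ⟨μ, ⟨⟨?_⟩, ?_, ?_⟩, ?_⟩
  · rw [hμs]
    simp only [Set.indicator_univ, Pi.one_apply, mul_one]
    rw [← ENNReal.ofReal_sum_of_nonneg fun x _ => hv0 x, hv1, ENNReal.ofReal_one]
  · exact hμS _ fun x hx hxc => hxc (hS.subset hx)
  · refine Measure.ext_of_singleton fun y => ?_
    rw [Measure.bind_apply (MeasurableSet.singleton _) (Kernel.aemeasurable _), hμ,
      lintegral_finsetSum_measure]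
    simp only [lintegral_smul_measure, lintegral_dirac, smul_eq_mul]
    rw [← hμ]
    by_cases hy : y ∈ S
    · have hμy : μ {y} = ENNReal.ofReal (v ⟨y, hy⟩) := by
        rw [hμs, Finset.sum_eq_single (⟨y, hy⟩ : S)]
        · simp
        · intro x _ hx
          rw [Set.indicator_of_notMem (fun h : (x : Site d) ∈ ({y} : Set (Site d)) =>
            hx (Subtype.ext h)), mul_zero]
        · simp
      rw [hμy, ← hv ⟨y, hy⟩, ENNReal.ofReal_sum_of_nonneg]
      · refine Finset.sum_congr rfl fun x _ => ?_
        rw [ENNReal.ofReal_mul (hv0 x), hsing]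
      · intro x _
        exact mul_nonneg (hv0 x) (Finset.sum_nonneg fun e _ =>
          mul_nonneg (prob_nonneg _ _ _) (by split_ifs <;> norm_num))
    · rw [hμS {y} (fun x hx h => hy (h ▸ hx))]
      refine Finset.sum_eq_zero fun x _ => ?_
      by_cases h : 0 < reflectedKernel ω N x {y}
      · obtain ⟨e, he, rfl⟩ := (reflectedKernel_singleton_pos _ _ _ _).1 h
        exact absurd (hS.closed x x.2 e he) hy
      · rw [nonpos_iff_eq_zero.1 (not_lt.1 h), mul_zero]
  · intro z hz
    by_contra hzS
    exact (ne_of_gt hz) (hμS {z} fun x hx h => hzS (h ▸ hx))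

/-- A support constant bounds the number of sites of every closed set of the reflected walk. -/
theorem IsReflectedSupportBound.card_ge {P : Measure (Env d)} {Φ : ℝ}
    (h : IsReflectedSupportBound P Φ) : ∀ᵐ ω ∂P, ∀ᶠ N : ℕ in atTop, ∀ S : Set (Site d),
      IsReflClosed ω N S → S.Nonempty → Φ * (N : ℝ) ^ d ≤ S.ncard := by
  filter_upwards [h] with ω hω
  filter_upwards [hω] with N hN S hS hne
  obtain ⟨μ, hμ, hsub⟩ := hS.exists_stationary hne
  exact (hN μ hμ).trans (by exact_mod_cast Set.ncard_le_ncard hsub hS.finite)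

/-- Otherwise axis i would almost surely be inactive at all sites at once. This is where genuine
d-dimensionality enters, as the strict decay rate. -/
theorem measure_inactive_lt_one {ν : Measure (LocalLaw d)} [IsProbabilityMeasure ν]
    (hgen : ∀ᵐ ω ∂envLaw ν, GenuinelyDDimensional ω) (i : Fin d) : ν (inactive i) < 1 := by
  by_contra hc
  have h1 : ν (inactive i) = 1 := le_antisymm prob_le_one (not_lt.1 hc)
  have h2 : ∀ᵐ l ∂ν, l ∈ inactive i := by
    rw [ae_iff]
    exact (prob_compl_eq_zero_iff (measurableSet_inactive i)).2 h1
  have h3 : ∀ᵐ ω ∂envLaw ν, ∀ z, ω z ∈ inactive i := by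
    rw [ae_all_iff]
    intro z
    exact (measurePreserving_eval_infinitePi (fun _ : Site d => ν) z).quasiMeasurePreserving.ae h2
  obtain ⟨ω, h4, h5⟩ := (h3.and hgen).exists
  obtain ⟨z, hz⟩ := h5 (i, true)
  exact h4 z hz

theorem dim_pos (ν : Measure (LocalLaw d)) [IsProbabilityMeasure ν] : 0 < d := by
  obtain ⟨l⟩ : Nonempty (LocalLaw d) := ν.nonempty_of_neZero
  by_contra h
  obtain rfl : d = 0 := by omega
  have := l.2.2
  simp at this

/-- A support constant exists. -/
theorem exists_supportBound (ν : Measure (LocalLaw d)) [IsProbabilityMeasure ν]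
    (hbal : ∀ᵐ ω ∂envLaw ν, Balanced ω) (hgen : ∀ᵐ ω ∂envLaw ν, GenuinelyDDimensional ω) :
    ∃ Φ : ℝ, 0 < Φ ∧ IsReflectedSupportBound (envLaw ν) Φ := by
  obtain ⟨Φ, hΦ, h⟩ := ae_eventually_card_ge (dim_pos ν) hbal (measure_inactive_lt_one hgen)
  refine ⟨Φ, hΦ, ?_⟩
  filter_upwards [h] with ω hω
  filter_upwards [hω] with N hN μ hμ
  exact hN _ hμ.isReflClosed hμ.nonempty

/-! ### Shifts of the environment and a zero-one law -/

theorem from_from (z w : Site d) (ω : Env d) : Env.from z (Env.from w ω) = Env.from (w + z) ω := by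
  ext1 y; simp [Env.from, add_assoc]

theorem from_zero (ω : Env d) : Env.from 0 ω = ω := by
  ext1 y; simp [Env.from]

theorem prob_from (z x : Site d) (ω : Env d) (e : Dir d) :
    (Env.from z ω).prob x e = ω.prob (z + x) e := rfl

theorem measurePreserving_from (ν : Measure (LocalLaw d)) [IsProbabilityMeasure ν] (z : Site d) :
    MeasurePreserving (Env.from z) (envLaw ν) (envLaw ν) :=
  ⟨measurable_from z, Measure.map_infinitePi_infinitePi_of_inj (P := fun _ : Site d => ν)
    (f := fun y => z + y) (add_right_injective z)⟩

theorem ae_forall_from {ν : Measure (LocalLaw d)} [IsProbabilityMeasure ν] {p : Env d → Prop}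
    (h : ∀ᵐ ω ∂envLaw ν, p ω) : ∀ᵐ ω ∂envLaw ν, ∀ z, p (Env.from z ω) := by
  rw [ae_all_iff]
  exact fun z => (measurePreserving_from ν z).quasiMeasurePreserving.ae h

/-- Measurable events are approximated by events depending on finitely many sites. -/
theorem exists_dependsOnSites (P : Measure (Env d)) [IsFiniteMeasure P] {F : Set (Env d)}
    (hF : MeasurableSet F) {ε : ℝ≥0∞} (hε : 0 < ε) :
    ∃ (S : Finset (Site d)) (C : Set (Env d)), MeasurableSet C ∧ DependsOnSites S C ∧
      P (symmDiff C F) < ε := by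
  obtain ⟨C, hC, h⟩ := exists_measure_symmDiff_lt_of_generateFrom_isSetRing (μ := P)
    (C := measurableCylinders fun _ : Site d => LocalLaw d) isSetRing_measurableCylinders
    ⟨{Set.univ}, Set.countable_singleton _, by
      simpa using univ_mem_measurableCylinders fun _ : Site d => LocalLaw d, by simp⟩
    generateFrom_measurableCylinders.symm hF hε
  obtain ⟨S, A, hA, rfl⟩ := (mem_measurableCylinders C).1 hC
  refine ⟨S, _, hA.cylinder _, fun ω ω' hω => ?_, h⟩
  simp only [mem_cylinder]
  rw [show S.restrict ω = S.restrict ω' from funext fun x => hω x x.2]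

/-- An event of positive probability occurs at some site, almost surely. -/
theorem ae_exists_from {ν : Measure (LocalLaw d)} [IsProbabilityMeasure ν] {E : Set (Env d)}
    (hE : MeasurableSet E) (hpos : envLaw ν E ≠ 0) : ∀ᵐ ω ∂envLaw ν, ∃ z, Env.from z ω ∈ E := by
  set P := envLaw ν with hP
  set F : Set (Env d) := {ω | ∃ z, Env.from z ω ∈ E} with hFdef
  have hF : MeasurableSet F := by
    have : F = ⋃ z, Env.from z ⁻¹' E := by ext; simp [hFdef]
    rw [this]
    exact MeasurableSet.iUnion fun z => measurable_from z hE
  have hinv : ∀ w, Env.from w ⁻¹' F = F := by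
    intro w
    ext ω
    simp only [hFdef, Set.mem_preimage, Set.mem_ofPred_eq, from_from]
    exact ⟨fun ⟨z, hz⟩ => ⟨_, hz⟩, fun ⟨z, hz⟩ => ⟨z - w, by simpa using hz⟩⟩
  -- F is shift-invariant, so a local event C close to F and a far shift of C are independent and
  -- both close to F. Hence P(F) ≤ P(C)^2 + 2ε ≤ P(F)^2 + 4ε, and in the limit P(F) is 0 or 1.
  have hreal : ∀ ε : ℝ, 0 < ε → P.real F - P.real F * P.real F ≤ 4 * ε := by
    intro ε hε
    obtain ⟨S, C, hC, hCS, hCF⟩ := exists_dependsOnSites P hF (ENNReal.ofReal_pos.2 hε)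
    have : Nonempty (Fin d) := ⟨⟨0, dim_pos ν⟩⟩
    -- A shift outside the finite difference set S - S moves S off itself.
    obtain ⟨w, hw⟩ := Infinite.exists_notMem_finset
      ((S ×ˢ S).image fun p : Site d × Site d => p.1 - p.2)
    have hdis : Disjoint S (S.map (addLeftEmbedding w)) := by
      rw [Finset.disjoint_left]
      intro x hx hxw
      obtain ⟨y, hy, rfl⟩ := Finset.mem_map.1 hxw
      exact hw (Finset.mem_image.2 ⟨(_, y), Finset.mem_product.2 ⟨hx, hy⟩, by
        simp [addLeftEmbedding]⟩)
    have hdep : DependsOnSites (S.map (addLeftEmbedding w)) (Env.from w ⁻¹' C) := by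
      intro ω ω' h
      exact hCS _ _ fun x hx => h _ (Finset.mem_map_of_mem _ hx)
    have hind := envLaw_inter (ν := ν) hdis hC (measurable_from w hC) hCS hdep
    rw [(measurePreserving_from ν w).measure_preimage hC.nullMeasurableSet] at hind
    have hind' : P.real (C ∩ Env.from w ⁻¹' C) = P.real C * P.real C := by
      simp [Measure.real, hP, hind, ENNReal.toReal_mul]
    have hsd : ∀ A : Set (Env d), P (symmDiff A F) < ENNReal.ofReal ε →
        P.real (A \ F) ≤ ε ∧ P.real (F \ A) ≤ ε := by
      intro A hA
      have h1 : P.real (symmDiff A F) ≤ ε := by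
        rw [Measure.real, ← ENNReal.le_ofReal_iff_toReal_le (measure_ne_top _ _) hε.le]
        exact hA.le
      exact ⟨(measureReal_mono (Set.subset_union_left)).trans h1,
        (measureReal_mono (Set.subset_union_right)).trans h1⟩
    obtain ⟨h1, h2⟩ := hsd C hCF
    have h3 : P.real (F \ Env.from w ⁻¹' C) ≤ ε := by
      have : F \ Env.from w ⁻¹' C = Env.from w ⁻¹' (F \ C) := by
        rw [Set.preimage_sdiff, hinv]
      rw [this, Measure.real,
        (measurePreserving_from ν w).measure_preimage (hF.diff hC).nullMeasurableSet]
      exact h2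
    have h4 : P.real F ≤ P.real (C ∩ Env.from w ⁻¹' C) + P.real (F \ C) +
        P.real (F \ Env.from w ⁻¹' C) := by
      refine (measureReal_mono (fun ω hω => ?_)).trans ((measureReal_union_le _ _).trans
        (add_le_add_left (measureReal_union_le _ _) _))
      by_cases hc : ω ∈ C
      · by_cases hcw : ω ∈ Env.from w ⁻¹' C
        · exact Or.inl (Or.inl ⟨hc, hcw⟩)
        · exact Or.inr ⟨hω, hcw⟩
      · exact Or.inl (Or.inr ⟨hω, hc⟩)
    have h5 : P.real C ≤ P.real F + ε := by
      refine (measureReal_mono (s₂ := F ∪ C \ F) fun ω hω => ?_).trans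
        ((measureReal_union_le _ _).trans (by linarith))
      by_cases h : ω ∈ F
      exacts [Or.inl h, Or.inr ⟨hω, h⟩]
    have h6 : P.real C ≤ 1 := measureReal_le_one
    have h7 : P.real F ≤ 1 := measureReal_le_one
    have h8 : 0 ≤ P.real C := measureReal_nonneg
    have h9 : 0 ≤ P.real F := measureReal_nonneg
    rw [hind'] at h4
    nlinarith
  have hle : P.real F - P.real F * P.real F ≤ 0 := by
    by_contra hc
    have := hreal ((P.real F - P.real F * P.real F) / 8) (by linarith)
    linarith
  have hpF : 0 < P.real F := by
    refine ENNReal.toReal_pos (fun h => hpos (measure_mono_null (fun ω hω => ?_) h))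
      (measure_ne_top _ _)
    exact ⟨0, by rwa [from_zero]⟩
  have h1 : P.real F = 1 := le_antisymm measureReal_le_one (by nlinarith)
  have h2 : P F = 1 := by
    rw [← ENNReal.ofReal_toReal (measure_ne_top P F)]
    change ENNReal.ofReal (P.real F) = 1
    rw [h1, ENNReal.ofReal_one]
  rw [ae_iff]
  exact (prob_compl_eq_zero_iff hF).2 h2

/-! ### Closed sets of the walk and sinks -/

/-- A set of sites which the walk cannot leave. -/
def WalkClosed (ω : Env d) (A : Set (Site d)) : Prop :=
  ∀ x ∈ A, ∀ e, 0 < ω.prob x e → x + e.vec ∈ A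

/-- A reflected move is either a move of the walk or no move, so every cube inherits closedness. -/
theorem WalkClosed.isReflClosed {ω : Env d} {A : Set (Site d)} (hA : WalkClosed ω A) (N : ℕ) :
    IsReflClosed ω N (A ∩ cube d N) := by
  refine ⟨Set.inter_subset_right, fun x hx e he => ⟨?_, refl_mem_cube hx.2 e⟩⟩
  unfold refl
  split_ifs
  exacts [hA x hx.1 e he, hx.1]

theorem WalkClosed.from {ω : Env d} {A : Set (Site d)} (hA : WalkClosed ω A) (z : Site d) :
    WalkClosed (Env.from z ω) {y | z + y ∈ A} := by
  intro x hx e he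
  have := hA (z + x) hx e he
  rwa [add_assoc] at this

theorem WalkClosed.mem_of_reach {ω : Env d} {A : Set (Site d)} (hA : WalkClosed ω A)
    {x y : Site d} (hx : x ∈ A) (h : Relation.ReflTransGen (Edge ω) x y) : y ∈ A := by
  induction h with
  | refl => exact hx
  | tail _ hbc ih =>
    obtain ⟨e, he, rfl⟩ := hbc
    exact hA _ ih e he

theorem IsSink.walkClosed {ω : Env d} {A : Set (Site d)} (hA : IsSink ω A) : WalkClosed ω A := by
  intro x hx e he
  by_contra h
  exact hA.closed x hx _ h ((reaches_iff _ _ _).2 (Relation.ReflTransGen.single ⟨e, he, rfl⟩))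

theorem IsSink.eq_of_mem {ω : Env d} {A B : Set (Site d)} (hA : IsSink ω A) (hB : IsSink ω B)
    {x : Site d} (hxA : x ∈ A) (hxB : x ∈ B) : A = B := by
  have key : ∀ {A B : Set (Site d)}, IsSink ω A → IsSink ω B → x ∈ A → x ∈ B → A ⊆ B := by
    intro A B hA hB hxA hxB y hy
    by_contra h
    exact hB.closed x hxB y h (hA.stronglyConnected x hxA y hy)
  exact (key hA hB hxA hxB).antisymm (key hB hA hxB hxA)

/-! ### Densities -/

theorem card_box (d N : ℕ) : (box d N).card = (2 * N + 1) ^ d := by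
  have : ((N : ℤ) + 1 + N).toNat = 2 * N + 1 := by omega
  simp [box, this]

theorem mem_box {N : ℕ} {z : Site d} : z ∈ box d N ↔ rad 0 z ≤ N := by
  simp [box, rad_le_iff, abs_le]

theorem boxDensity_nonneg (A : Set (Site d)) (N : ℕ) : 0 ≤ boxDensity A N := by
  unfold boxDensity; positivity

theorem boxDensity_le_one (A : Set (Site d)) (N : ℕ) : boxDensity A N ≤ 1 := by
  unfold boxDensity
  refine div_le_one_of_le₀ ?_ (by positivity)
  rw [← Set.ncard_coe_finset]
  exact_mod_cast Set.ncard_le_ncard Set.inter_subset_right (Finset.finite_toSet _)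

theorem isBoundedUnder_le_boxDensity (A : Set (Site d)) :
    IsBoundedUnder (· ≤ ·) atTop (boxDensity A) :=
  isBoundedUnder_of ⟨1, boxDensity_le_one A⟩

theorem isBoundedUnder_ge_boxDensity (A : Set (Site d)) :
    IsBoundedUnder (· ≥ ·) atTop (boxDensity A) :=
  isBoundedUnder_of ⟨0, boxDensity_nonneg A⟩

theorem lowerDensity_le_upperDensity (A : Set (Site d)) : lowerDensity A ≤ upperDensity A :=
  liminf_le_limsup (isBoundedUnder_le_boxDensity A) (isBoundedUnder_ge_boxDensity A)

theorem tendsto_sub_div (r : ℕ) :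
    Tendsto (fun M : ℕ => ((M - r : ℕ) : ℝ) / (2 * M + 1)) atTop (nhds (1 / 2)) := by
  have h1 : Tendsto (fun M : ℕ => (2 * M + 1 : ℝ)) atTop atTop :=
    tendsto_atTop_add_const_right _ _
      ((tendsto_natCast_atTop_atTop (R := ℝ)).const_mul_atTop (by norm_num))
  have h2 : Tendsto (fun M : ℕ => (1 / 2 : ℝ) - (r + 1 / 2) / (2 * M + 1)) atTop
      (nhds (1 / 2 - 0)) := tendsto_const_nhds.sub (h1.const_div_atTop _)
  rw [sub_zero] at h2
  refine h2.congr' ?_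
  filter_upwards [eventually_ge_atTop r] with M hM
  rw [Nat.cast_sub hM]
  have : (2 * M + 1 : ℝ) ≠ 0 := by positivity
  field_simp
  ring

/-- A closed set of the walk that contains `x` has a positive lower density if the closed sets of
the reflected walks near `x` have. -/
theorem le_lowerDensity {ω : Env d} {Φ : ℝ} {A : Set (Site d)} (hA : WalkClosed ω A) {x : Site d}
    (hx : x ∈ A) (h : ∀ᶠ N : ℕ in atTop, ∀ S : Set (Site d), IsReflClosed (Env.from x ω) N S →
      S.Nonempty → Φ * (N : ℝ) ^ d ≤ S.ncard) : Φ / 2 ^ d ≤ lowerDensity A := by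
  set r := rad 0 x with hr
  have hlim : Tendsto (fun M : ℕ => Φ * (((M - r : ℕ) : ℝ) / (2 * M + 1)) ^ d) atTop
      (nhds (Φ * (1 / 2) ^ d)) := ((tendsto_sub_div r).pow d).const_mul Φ
  have heq : Φ / 2 ^ d = Φ * (1 / 2) ^ d := by rw [div_pow, one_pow]; ring
  rw [heq, ← hlim.liminf_eq]
  refine liminf_le_liminf ?_ hlim.isBoundedUnder_ge
    (isBoundedUnder_le_boxDensity A).isCoboundedUnder_ge
  have h2 := (tendsto_sub_atTop_nat r).eventually h
  filter_upwards [h2, eventually_gt_atTop r] with M hM hMr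
  have h3 := hM _ ((hA.from x).isReflClosed (M - r)) ⟨0, by simpa using hx, fun i => by
    simp only [Pi.zero_apply]; omega⟩
  -- The cube of side M - r with lowest corner x fits into [-M, M]^d, of which it asymptotically
  -- fills the fraction 2^{-d}. Its corner lies in A, so the trace of A is nonempty.
  have h4 : ({y | x + y ∈ A} ∩ cube d (M - r)).ncard ≤ (A ∩ (box d M : Set (Site d))).ncard := by
    refine Set.ncard_le_ncard_of_injOn (fun y => x + y) ?_ (add_right_injective x).injOn
      ((Finset.finite_toSet _).subset Set.inter_subset_right)
    rintro y ⟨hy, hyc⟩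
    refine ⟨hy, ?_⟩
    rw [Finset.mem_coe, mem_box, rad_le_iff]
    intro j
    have h5 := abs_le.1 (rad_le_iff.1 hr.ge j)
    have h6 := hyc j
    simp only [Pi.add_apply, Pi.zero_apply] at *
    rw [abs_le]; omega
  unfold boxDensity
  rw [card_box, le_div_iff₀ (by positivity)]
  calc Φ * (((M - r : ℕ) : ℝ) / (2 * M + 1)) ^ d * ((2 * M + 1) ^ d : ℕ)
      = Φ * ((M - r : ℕ) : ℝ) ^ d := by
        push_cast
        rw [div_pow]; field_simp
    _ ≤ _ := h3.trans (by exact_mod_cast h4)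

/-- The support bound holds almost surely in all cubes with corner x, simultaneously for the
countably many x; a corner inside the sink is then available. -/
theorem IsReflectedSupportBound.ae_le_lowerDensity {ν : Measure (LocalLaw d)}
    [IsProbabilityMeasure ν] {Φ : ℝ} (h : IsReflectedSupportBound (envLaw ν) Φ) :
    ∀ᵐ ω ∂envLaw ν, ∀ S : Set (Site d), IsSink ω S → Φ / 2 ^ d ≤ lowerDensity S := by
  filter_upwards [ae_forall_from h.card_ge] with ω hω S hS
  obtain ⟨x, hx⟩ := hS.nonempty
  exact le_lowerDensity hS.walkClosed hx (hω x)

/-- There are only finitely many sinks if their lower densities are bounded below. -/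
theorem finite_setOf_isSink {ω : Env d} {c : ℝ} (hc : 0 < c)
    (h : ∀ S : Set (Site d), IsSink ω S → c ≤ lowerDensity S) : {S | IsSink ω S}.Finite := by
  classical
  by_contra hinf
  -- More than 2/c disjoint sinks, each of density above c/2 in a common box, would exceed total
  -- density 1.
  obtain ⟨m, hm⟩ := exists_nat_gt (2 / c)
  obtain ⟨T, hT, hTm⟩ := Set.Infinite.exists_subset_card_eq (show Set.Infinite _ from hinf) m
  have hev : ∀ᶠ N in atTop, ∀ S ∈ T, c / 2 < boxDensity S N := by
    rw [Filter.eventually_all_finset]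
    intro S hS
    exact eventually_lt_of_lt_liminf ((half_lt_self hc).trans_le (h S (hT hS)))
      (isBoundedUnder_ge_boxDensity S)
  obtain ⟨N, hN⟩ := hev.exists
  have hcard : ∀ S : Set (Site d), (S ∩ (box d N : Set (Site d))).ncard =
      ((box d N).filter (· ∈ S)).card := by
    intro S
    rw [← Set.ncard_coe_finset]
    congr 1
    ext x
    simp [and_comm]
  have hsum : ∑ S ∈ T, ((box d N).filter (· ∈ S)).card ≤ (box d N).card := by
    rw [← Finset.card_biUnion]
    · exact Finset.card_le_card (Finset.biUnion_subset.2 fun S _ => Finset.filter_subset _ _)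
    · intro S hS S' hS' hne
      rw [Function.onFun, Finset.disjoint_left]
      intro x hx hx'
      exact hne ((hT hS).eq_of_mem (hT hS') (Finset.mem_filter.1 hx).2 (Finset.mem_filter.1 hx').2)
  have hpos : (0 : ℝ) < (box d N).card := by rw [card_box]; positivity
  have h1 : ∑ S ∈ T, boxDensity S N ≤ 1 := by
    simp only [boxDensity, hcard]
    rw [← Finset.sum_div, div_le_one hpos]
    exact_mod_cast hsum
  have h2 : ∑ S ∈ T, c / 2 ≤ ∑ S ∈ T, boxDensity S N :=
    Finset.sum_le_sum fun S hS => (hN S hS).le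
  rw [Finset.sum_const, hTm, nsmul_eq_mul] at h2
  rw [div_lt_iff₀ hc] at hm
  linarith

/-! ### Measurability of reachability, and the event that the origin lies in a sink -/

/-- `y` is reached from `x` in `n` steps of positive probability. -/
def ReachIn (ω : Env d) : ℕ → Site d → Site d → Prop
  | 0, x, y => x = y
  | n + 1, x, y => ∃ e : Dir d, 0 < ω.prob x e ∧ ReachIn ω n (x + e.vec) y

theorem reach_iff (ω : Env d) (x y : Site d) :
    Relation.ReflTransGen (Edge ω) x y ↔ ∃ n, ReachIn ω n x y := by
  constructor
  · intro h
    induction h using Relation.ReflTransGen.head_induction_on with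
    | refl => exact ⟨0, rfl⟩
    | head hab _ ih =>
      obtain ⟨e, he, rfl⟩ := hab
      obtain ⟨n, hn⟩ := ih
      exact ⟨n + 1, e, he, hn⟩
  · rintro ⟨n, hn⟩
    induction n generalizing x with
    | zero => rw [show x = y from hn]
    | succ n ih =>
      obtain ⟨e, he, h⟩ := hn
      exact Relation.ReflTransGen.head ⟨e, he, rfl⟩ (ih _ h)

theorem measurableSet_reachIn (n : ℕ) (x y : Site d) :
    MeasurableSet {ω : Env d | ReachIn ω n x y} := by
  induction n generalizing x with
  | zero => exact MeasurableSet.const _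
  | succ n ih =>
    simp only [ReachIn, Set.ofPred_exists, Set.ofPred_and]
    exact MeasurableSet.iUnion fun e =>
      (measurableSet_lt measurable_const (measurable_prob x e)).inter (ih _)

theorem measurableSet_reach (x y : Site d) :
    MeasurableSet {ω : Env d | Relation.ReflTransGen (Edge ω) x y} := by
  simp only [reach_iff, Set.ofPred_exists]
  exact MeasurableSet.iUnion fun n => measurableSet_reachIn n x y

theorem reachIn_from (ω : Env d) (z : Site d) (n : ℕ) (x y : Site d) :
    ReachIn (Env.from z ω) n x y ↔ ReachIn ω n (z + x) (z + y) := by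
  induction n generalizing x with
  | zero => simp [ReachIn]
  | succ n ih => simp only [ReachIn, ih, prob_from, add_assoc]

theorem reach_from (ω : Env d) (z x y : Site d) :
    Relation.ReflTransGen (Edge (Env.from z ω)) x y ↔
      Relation.ReflTransGen (Edge ω) (z + x) (z + y) := by
  simp only [reach_iff, reachIn_from]

/-- The environments in which the origin belongs to a sink. -/
def originInSink (d : ℕ) : Set (Env d) :=
  {ω | ∀ y, Relation.ReflTransGen (Edge ω) 0 y → Relation.ReflTransGen (Edge ω) y 0}

/-- The walk started at the origin can return from all the sites it reaches in `k` steps. -/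
def returnsFrom (d k : ℕ) : Set (Env d) :=
  {ω | ∀ n ≤ k, ∀ y, ReachIn ω n 0 y → Relation.ReflTransGen (Edge ω) y 0}

/-- Membership in a sink cannot be read off from a finite cube, but each truncation to k steps can
be forced by one. The truncations decrease to the full event. -/
theorem originInSink_eq : originInSink d = ⋂ k, returnsFrom d k := by
  ext ω
  simp only [originInSink, returnsFrom, Set.mem_iInter, Set.mem_ofPred_eq, reach_iff ω 0]
  exact ⟨fun h k n _ y hy => h y ⟨n, hy⟩, fun h y ⟨n, hn⟩ => h n n le_rfl y hn⟩

theorem measurableSet_returnsFrom (k : ℕ) : MeasurableSet (returnsFrom d k) := by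
  simp only [returnsFrom, Set.ofPred_forall]
  refine MeasurableSet.iInter fun n => MeasurableSet.iInter fun _ => MeasurableSet.iInter fun y => ?_
  exact (measurableSet_reachIn n 0 y).himp (measurableSet_reach y 0)

theorem measurableSet_originInSink : MeasurableSet (originInSink d) := by
  rw [originInSink_eq]
  exact MeasurableSet.iInter measurableSet_returnsFrom

theorem from_mem_originInSink {ω : Env d} {z : Site d} : Env.from z ω ∈ originInSink d ↔
    ∀ y, Relation.ReflTransGen (Edge ω) z y → Relation.ReflTransGen (Edge ω) y z := by
  simp only [originInSink, Set.mem_ofPred_eq, reach_from, add_zero]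
  exact ⟨fun h y hy => by simpa using h (y - z) (by simpa using hy), fun h y hy => h _ hy⟩

theorem isSink_reach {ω : Env d} {z : Site d} (h : Env.from z ω ∈ originInSink d) :
    IsSink ω {y | Relation.ReflTransGen (Edge ω) z y} := by
  rw [from_mem_originInSink] at h
  refine ⟨⟨z, Relation.ReflTransGen.refl⟩, fun x hx y hy => ?_, fun x hx y hy hr => ?_⟩
  · exact (reaches_iff _ _ _).2 ((h x hx).trans hy)
  · exact hy (Relation.ReflTransGen.trans hx ((reaches_iff _ _ _).1 hr))

/-! ### From connected closed sets in cubes to sinks of positive probability -/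

/-- One step of the walk reflected at the boundary of the cube. -/
def ReflEdge (ω : Env d) (N : ℕ) (x y : Site d) : Prop := ∃ e, 0 < ω.prob x e ∧ y = refl N x e

theorem reach_of_reflReach {ω : Env d} {N : ℕ} {x y : Site d}
    (h : Relation.ReflTransGen (ReflEdge ω N) x y) : Relation.ReflTransGen (Edge ω) x y := by
  induction h with
  | refl => exact Relation.ReflTransGen.refl
  | @tail b c _ hbc ih =>
    obtain ⟨e, he, rfl⟩ := hbc
    unfold refl
    split_ifs
    exacts [ih.tail ⟨e, he, rfl⟩, ih]

/-- A closed set of the reflected walk contains a closed set that is strongly connected. -/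
theorem IsReflClosed.exists_connected {ω : Env d} {N : ℕ} {S : Set (Site d)}
    (hS : IsReflClosed ω N S) (hne : S.Nonempty) : ∃ T ⊆ S, IsReflClosed ω N T ∧ T.Nonempty ∧
      ∀ x ∈ T, ∀ y ∈ T, Relation.ReflTransGen (Edge ω) x y := by
  have hfin : {T | T ⊆ S ∧ IsReflClosed ω N T ∧ T.Nonempty}.Finite :=
    hS.finite.finite_subsets.subset fun T hT => hT.1
  obtain ⟨T, hT⟩ := hfin.exists_minimal ⟨S, subset_rfl, hS, hne⟩
  obtain ⟨hTS, hTc, hTne⟩ := hT.prop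
  refine ⟨T, hTS, hTc, hTne, fun x hx y hy => reach_of_reflReach (N := N) ?_⟩
  -- The part of T reached from x is closed and nonempty, so minimality makes it all of T.
  set U : Set (Site d) := {y | y ∈ T ∧ Relation.ReflTransGen (ReflEdge ω N) x y} with hU
  have hUT : U ⊆ T := fun y hy => hy.1
  have hUc : IsReflClosed ω N U := ⟨hUT.trans hTc.subset, fun y hy e he =>
    ⟨hTc.closed y hy.1 e he, hy.2.tail ⟨e, he, rfl⟩⟩⟩
  exact (hT.le_of_le ⟨hUT.trans hTS, hUc, ⟨x, hx, Relation.ReflTransGen.refl⟩⟩ hUT hy).2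

/-- The sites of the cube at distance at least `k` from the complement. -/
noncomputable def innerCube (d N k : ℕ) : Finset (Site d) :=
  Fintype.piFinset fun _ => Finset.Ico (k : ℤ) (N - k : ℤ)

theorem card_innerCube {N k : ℕ} (h : 2 * k ≤ N) : (innerCube d N k).card = (N - 2 * k) ^ d := by
  have : ((N : ℤ) - k - k).toNat = N - 2 * k := by omega
  simp [innerCube, this]

/-- A path of n steps from a site at depth n stays in the cube, so the reflected walk can follow it
too. -/
theorem IsReflClosed.mem_of_reachIn {ω : Env d} {N : ℕ} {T : Set (Site d)}
    (hT : IsReflClosed ω N T) {n : ℕ} {x y : Site d} (hx : x ∈ T)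
    (hxn : ∀ j, (n : ℤ) ≤ x j ∧ x j < N - n) (h : ReachIn ω n x y) : y ∈ T := by
  induction n generalizing x with
  | zero => exact (show x = y from h) ▸ hx
  | succ n ih =>
    obtain ⟨e, he, h⟩ := h
    have hstep : ∀ j, (n : ℤ) ≤ (x + e.vec) j ∧ (x + e.vec) j < N - n := by
      intro j
      have h1 := abs_le.1 (abs_vec_le e j)
      have h2 := hxn j
      simp only [Pi.add_apply]
      push_cast at h2
      omega
    refine ih ?_ hstep h
    have h1 := hT.closed x hx e he
    rwa [refl, if_pos (show x + e.vec ∈ cube d N from fun j => by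
      have := hstep j; omega)] at h1

theorem tendsto_inner_ratio (d k : ℕ) :
    Tendsto (fun N : ℕ => (1 - (2 * k : ℝ) / N) ^ d) atTop (nhds 1) := by
  have h : Tendsto (fun N : ℕ => 1 - (2 * k : ℝ) / N) atTop (nhds (1 - 0)) :=
    tendsto_const_nhds.sub (tendsto_natCast_atTop_atTop.const_div_atTop _)
  simpa using h.pow d

open Classical in
/-- In large cubes many sites of a closed set can be returned to from their neighbourhoods. -/
theorem eventually_card_returns {ω : Env d} {Φ : ℝ} (hΦ : 0 < Φ) {A : Set (Site d)}
    (hA : WalkClosed ω A) (h0 : 0 ∈ A) (h : ∀ᶠ N : ℕ in atTop, ∀ S : Set (Site d),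
      IsReflClosed ω N S → S.Nonempty → Φ * (N : ℝ) ^ d ≤ S.ncard) (k : ℕ) :
    ∀ᶠ N : ℕ in atTop, Φ / 2 * (N : ℝ) ^ d ≤
      (((cubeFinset d N).filter fun z => z ∈ A ∧ Env.from z ω ∈ returnsFrom d k).card : ℝ) := by
  -- The boundary layer of width k takes up less than Φ/2 of the cube, so at least Φ/2 of the
  -- density Φ of T remains in the inner cube.
  have hr : ∀ᶠ N : ℕ in atTop, 1 - Φ / 2 < (1 - (2 * k : ℝ) / N) ^ d :=
    (tendsto_inner_ratio d k).eventually_const_lt (by linarith)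
  filter_upwards [h, hr, eventually_gt_atTop (2 * k)] with N hN hrN hkN
  obtain ⟨T, hTA, hTc, hTne, hcon⟩ := (hA.isReflClosed N).exists_connected
    ⟨0, h0, fun i => by simp only [Pi.zero_apply]; omega⟩
  have h1 := hN T hTc hTne
  have hfin := hTc.finite
  have hsub : hfin.toFinset ⊆ ((cubeFinset d N).filter
      fun z => z ∈ A ∧ Env.from z ω ∈ returnsFrom d k) ∪ (cubeFinset d N \ innerCube d N k) := by
    intro z hz
    rw [Set.Finite.mem_toFinset] at hz
    have hzc := mem_cubeFinset.2 (hTc.subset hz)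
    rw [Finset.mem_union]
    by_cases hi : z ∈ innerCube d N k
    · refine Or.inl (Finset.mem_filter.2 ⟨hzc, (hTA hz).1, ?_⟩)
      intro n hn y hy
      rw [reachIn_from, add_zero] at hy
      rw [reach_from, add_zero]
      refine hcon _ (hTc.mem_of_reachIn hz (fun j => ?_) hy) _ hz
      have := Finset.mem_Ico.1 (Fintype.mem_piFinset.1 hi j)
      omega
    · exact Or.inr (Finset.mem_sdiff.2 ⟨hzc, hi⟩)
  have hcard := (Finset.card_le_card hsub).trans (Finset.card_union_le _ _)
  rw [← Set.ncard_eq_toFinset_card T hfin] at hcard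
  have hinner : innerCube d N k ⊆ cubeFinset d N := by
    refine Fintype.piFinset_subset _ _ fun j => Finset.Ico_subset_Ico ?_ ?_ <;> omega
  rw [Finset.card_sdiff_of_subset hinner, card_cubeFinset, card_innerCube hkN.le] at hcard
  have hle : (N - 2 * k) ^ d ≤ N ^ d := Nat.pow_le_pow_left (by omega) d
  have hcard' : (T.ncard : ℝ) ≤ (((cubeFinset d N).filter
      fun z => z ∈ A ∧ Env.from z ω ∈ returnsFrom d k).card : ℝ) +
        ((N : ℝ) ^ d - ((N : ℝ) - 2 * k) ^ d) := by
    have := (Nat.cast_le (α := ℝ)).2 hcard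
    rw [Nat.cast_add, Nat.cast_sub hle, Nat.cast_pow, Nat.cast_pow, Nat.cast_sub hkN.le] at this
    push_cast at this
    exact this
  have hNpos : (0 : ℝ) < N := by exact_mod_cast (by omega : 0 < N)
  have hpow : ((N : ℝ) - 2 * k) ^ d = (1 - (2 * k : ℝ) / N) ^ d * (N : ℝ) ^ d := by
    rw [← mul_pow]; congr 1; field_simp
  have h3 : (1 - Φ / 2) * (N : ℝ) ^ d ≤ ((N : ℝ) - 2 * k) ^ d := by
    rw [hpow]; exact mul_le_mul_of_nonneg_right hrN.le (by positivity)
  nlinarith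

/-- If the walk started at sites where the environment belongs to `E` cannot leave the set of
these sites, then the origin belongs with positive probability to a sink and to this set. -/
theorem measure_inter_originInSink_pos {ν : Measure (LocalLaw d)} [IsProbabilityMeasure ν]
    {Φ : ℝ} (hΦ : 0 < Φ) (h : IsReflectedSupportBound (envLaw ν) Φ) {E : Set (Env d)}
    (hE : MeasurableSet E) (hpos : envLaw ν E ≠ 0)
    (hcl : ∀ᵐ ω ∂envLaw ν, WalkClosed ω {z | Env.from z ω ∈ E}) :
    envLaw ν (E ∩ originInSink d) ≠ 0 := by
  classical
  -- The frequency `F N` of such sites in the cube has mean at most the right-hand side, by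
  -- stationarity, and its liminf is at least Φ/2 on E. Fatou's lemma compares the two. The bound is
  -- uniform in k, so it survives the decreasing limit.
  have hlow : ∀ k, ENNReal.ofReal (Φ / 2) * envLaw ν E ≤ envLaw ν (E ∩ returnsFrom d k) := by
    intro k
    have hG : MeasurableSet (E ∩ returnsFrom d k) := hE.inter (measurableSet_returnsFrom k)
    set F : ℕ → Env d → ℝ≥0∞ := fun N ω =>
      (∑ z ∈ cubeFinset d N, (E ∩ returnsFrom d k).indicator 1 (Env.from z ω)) *
        ((N : ℝ≥0∞) ^ d)⁻¹ with hF
    have hind : ∀ z : Site d, Measurable fun ω : Env d =>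
        (E ∩ returnsFrom d k).indicator (1 : Env d → ℝ≥0∞) (Env.from z ω) := fun z =>
      (measurable_one.indicator hG).comp (measurable_from z)
    have hFm : ∀ N, Measurable (F N) := fun N =>
      (Finset.measurable_fun_sum _ fun z _ => hind z).mul_const _
    have hFint : ∀ N, ∫⁻ ω, F N ω ∂envLaw ν ≤ envLaw ν (E ∩ returnsFrom d k) := by
      intro N
      rw [hF]
      dsimp only
      rw [lintegral_mul_const _ (Finset.measurable_fun_sum _ fun z _ => hind z),
        lintegral_finsetSum _ fun z _ => hind z]
      have : ∀ z, ∫⁻ ω, (E ∩ returnsFrom d k).indicator (1 : Env d → ℝ≥0∞) (Env.from z ω)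
          ∂envLaw ν =
          envLaw ν (E ∩ returnsFrom d k) := by
        intro z
        rw [(measurePreserving_from ν z).lintegral_comp (measurable_one.indicator hG),
          lintegral_indicator_one hG]
      simp only [this, Finset.sum_const, card_cubeFinset, nsmul_eq_mul]
      push_cast
      rw [mul_comm, ← mul_assoc]
      refine (mul_le_mul_left (ENNReal.inv_mul_le_one _) _).trans ?_
      rw [one_mul]
    calc ENNReal.ofReal (Φ / 2) * envLaw ν E
        = ∫⁻ ω, E.indicator (fun _ => ENNReal.ofReal (Φ / 2)) ω ∂envLaw ν := by
          rw [lintegral_indicator_const hE]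
      _ ≤ ∫⁻ ω, liminf (fun N => F N ω) atTop ∂envLaw ν := by
          refine lintegral_mono_ae ?_
          filter_upwards [hcl, h.card_ge] with ω hω hω2
          by_cases hωE : ω ∈ E
          · rw [Set.indicator_of_mem hωE]
            refine le_liminf_of_le (by isBoundedDefault) ?_
            filter_upwards [eventually_card_returns hΦ hω (by
              change Env.from 0 ω ∈ E; rwa [from_zero]) hω2 k, eventually_gt_atTop 0] with N hN hN0
            rw [hF]
            dsimp only
            have hsum : ∑ z ∈ cubeFinset d N,
                (E ∩ returnsFrom d k).indicator (1 : Env d → ℝ≥0∞) (Env.from z ω) =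
                (((cubeFinset d N).filter fun z => z ∈ {z | Env.from z ω ∈ E} ∧
                  Env.from z ω ∈ returnsFrom d k).card : ℝ≥0∞) := by
              rw [Finset.card_filter]
              push_cast
              refine Finset.sum_congr rfl fun z _ => ?_
              by_cases hz : Env.from z ω ∈ E ∩ returnsFrom d k
              · rw [Set.indicator_of_mem hz]; exact (if_pos hz).symm
              · rw [Set.indicator_of_notMem hz]; exact (if_neg hz).symm
            rw [hsum, ← div_eq_mul_inv, ENNReal.le_div_iff_mul_le (Or.inl (by positivity))
              (Or.inl (by finiteness))]
            have h2 := ENNReal.ofReal_le_ofReal hN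
            rw [ENNReal.ofReal_mul (by positivity), ENNReal.ofReal_pow (by positivity),
              ENNReal.ofReal_natCast, ENNReal.ofReal_natCast] at h2
            exact h2
          · rw [Set.indicator_of_notMem hωE]; exact zero_le
      _ ≤ liminf (fun N => ∫⁻ ω, F N ω ∂envLaw ν) atTop := lintegral_liminf_le hFm
      _ ≤ liminf (fun _ : ℕ => envLaw ν (E ∩ returnsFrom d k)) atTop :=
          liminf_le_liminf (Eventually.of_forall hFint)
      _ = _ := by simp
  have hlim := tendsto_measure_iInter_atTop (μ := envLaw ν)
    (s := fun k => E ∩ returnsFrom d k)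
    (fun k => (hE.inter (measurableSet_returnsFrom k)).nullMeasurableSet)
    (fun k l hkl ω hω => ⟨hω.1, fun n hn => hω.2 n (hn.trans hkl)⟩) ⟨0, measure_ne_top _ _⟩
  have hfin := ge_of_tendsto' hlim hlow
  rw [originInSink_eq, Set.inter_iInter]
  intro h0
  rw [h0] at hfin
  have : ENNReal.ofReal (Φ / 2) * envLaw ν E ≠ 0 :=
    mul_ne_zero (by simpa using hΦ) hpos
  exact this (nonpos_iff_eq_zero.1 hfin)

/-! ### The environment viewed from the particle and the support of Q -/

theorem particleKernel_apply (ω : Env d) {s : Set (Env d)} (hs : MeasurableSet s) :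
    particleKernel d ω s =
      ∑ e : Dir d, ENNReal.ofReal (ω.prob 0 e) * s.indicator 1 (Env.from e.vec ω) := by
  change (∑ e : Dir d, ENNReal.ofReal (ω.prob 0 e) • Measure.dirac (Env.from e.vec ω)) s = _
  simp [Measure.finsetSum_apply, Measure.dirac_apply' _ hs]

theorem particleKernel_eq_one (ω : Env d) {s : Set (Env d)} (hs : MeasurableSet s)
    (h : ∀ e : Dir d, 0 < ω.prob 0 e → Env.from e.vec ω ∈ s) : particleKernel d ω s = 1 := by
  rw [particleKernel_apply ω hs, ← Env.sum_ofReal_prob ω 0]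
  refine Finset.sum_congr rfl fun e _ => ?_
  rcases (prob_nonneg ω 0 e).eq_or_lt with h0 | h0
  · simp [← h0]
  · simp [h e h0]

theorem lintegral_particleKernel {Q : Measure (Env d)} (hQ : (particleKernel d).Invariant Q)
    {s : Set (Env d)} (hs : MeasurableSet s) : ∫⁻ ω, particleKernel d ω s ∂Q = Q s := by
  rw [← Measure.bind_apply hs (Kernel.aemeasurable _), hQ.def]

/-- The environments where the density of `Q` with respect to `P` is positive. -/
def densitySupport (P Q : Measure (Env d)) : Set (Env d) := {ω | 0 < Q.rnDeriv P ω}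

theorem measurableSet_densitySupport (P Q : Measure (Env d)) :
    MeasurableSet (densitySupport P Q) :=
  measurableSet_lt measurable_const (Measure.measurable_rnDeriv Q P)

section Admissible

variable {P Q : Measure (Env d)} [IsProbabilityMeasure P] [IsProbabilityMeasure Q]

theorem ae_mem_densitySupport (hac : Q ≪ P) : ∀ᵐ ω ∂Q, ω ∈ densitySupport P Q :=
  Measure.rnDeriv_pos hac

theorem measure_densitySupport_ne_zero (hac : Q ≪ P) : P (densitySupport P Q) ≠ 0 := fun h => by
  have h1 : ∀ᵐ ω ∂Q, ω ∉ densitySupport P Q := measure_eq_zero_iff_ae_notMem.1 (hac h)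
  obtain ⟨ω, h2, h3⟩ := (h1.and (ae_mem_densitySupport hac)).exists
  exact h2 h3

/-- Since Q is its density times P, the two measures have the same null sets within the density
support. -/
theorem ae_densitySupport_imp (hac : Q ≪ P) {p : Env d → Prop} (h : ∀ᵐ ω ∂Q, p ω) :
    ∀ᵐ ω ∂P, ω ∈ densitySupport P Q → p ω := by
  rw [← Measure.withDensity_rnDeriv_eq Q P hac,
    ae_withDensity_iff (Measure.measurable_rnDeriv Q P)] at h
  filter_upwards [h] with ω hω hmem using hω (ne_of_gt hmem)

/-- By invariance, the Q-mass outside the density support, which is zero, is also the mean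
probability of stepping there. -/
theorem ae_from_vec_mem (hac : Q ≪ P) (hinv : (particleKernel d).Invariant Q) :
    ∀ᵐ ω ∂Q, ∀ e : Dir d, 0 < ω.prob 0 e → Env.from e.vec ω ∈ densitySupport P Q := by
  have hE := (measurableSet_densitySupport P Q).compl
  have h0 : Q (densitySupport P Q)ᶜ = 0 := ae_mem_densitySupport hac
  rw [← lintegral_particleKernel hinv hE,
    lintegral_eq_zero_iff (Kernel.measurable_coe _ hE)] at h0
  filter_upwards [h0] with ω hω e he
  rw [particleKernel_apply ω hE] at hω
  have h1 := Finset.sum_eq_zero_iff.1 hω e (Finset.mem_univ e)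
  by_contra hn
  rw [Set.indicator_of_mem (show Env.from e.vec ω ∈ (densitySupport P Q)ᶜ from hn)] at h1
  simp [not_le.2 he] at h1

end Admissible

section Law

variable {ν : Measure (LocalLaw d)} [IsProbabilityMeasure ν] {Q : Measure (Env d)}

theorem ae_walkClosed_suppAt (hQ : IsErgodicInvariant Q) (hac : Q ≪ envLaw ν) :
    ∀ᵐ ω ∂envLaw ν, WalkClosed ω (suppAt (envLaw ν) Q ω) := by
  have := hQ.prob
  filter_upwards [ae_forall_from (ae_densitySupport_imp hac (ae_from_vec_mem hac hQ.invariant))]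
    with ω hω x hx e he
  have := hω x hx e (by simpa [prob_from] using he)
  rwa [from_from] at this

theorem particleKernel_originInSink {ω : Env d} (hω : ω ∈ originInSink d) :
    particleKernel d ω (originInSink d) = 1 :=
  particleKernel_eq_one ω measurableSet_originInSink fun e he =>
    have h0 : Relation.ReflTransGen (Edge ω) 0 e.vec := .single ⟨e, he, by simp⟩
    from_mem_originInSink.2 fun y hy => (hω y (h0.trans hy)).trans h0

/-- Started from its invariant law, the walk in an admissible environment sits in a sink. -/
theorem ae_mem_originInSink (hQ : IsErgodicInvariant Q) (hac : Q ≪ envLaw ν) {Φ : ℝ} (hΦ : 0 < Φ)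
    (h : IsReflectedSupportBound (envLaw ν) Φ) : ∀ᵐ ω ∂Q, ω ∈ originInSink d := by
  have := hQ.prob
  have hA := measurableSet_originInSink (d := d)
  -- The walk cannot leave a sink, so the indicator is subharmonic. Invariance gives both sides the
  -- same integral, hence the indicator is harmonic and ergodicity leaves only probability 0 or 1.
  have hle : (originInSink d).indicator 1 ≤ᵐ[Q] fun ω => particleKernel d ω (originInSink d) :=
    .of_forall fun ω => by
      by_cases hω : ω ∈ originInSink d
      · simp [hω, particleKernel_originInSink hω]
      · simp [hω]
  have hint : ∫⁻ ω, (originInSink d).indicator 1 ω ∂Q = Q (originInSink d) :=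
    lintegral_indicator_one hA
  have heq := ae_eq_of_ae_le_of_lintegral_le hle (by rw [hint]; exact measure_ne_top _ _)
    (Kernel.measurable_coe _ hA).aemeasurable
    (by rw [hint, lintegral_particleKernel hQ.invariant hA])
  rcases hQ.ergodic _ hA (by filter_upwards [heq] with ω hω using hω.symm) with h0 | h1
  -- Probability zero would make the density support and `originInSink` disjoint up to a P-null set,
  -- against their positive common probability.
  · have h2 := ae_densitySupport_imp hac (measure_eq_zero_iff_ae_notMem.1 h0)
    refine absurd ?_ (measure_inter_originInSink_pos hΦ h (measurableSet_densitySupport _ Q)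
      (measure_densitySupport_ne_zero hac) (ae_walkClosed_suppAt hQ hac))
    refine measure_eq_zero_iff_ae_notMem.2 ?_
    filter_upwards [h2] with ω hω hmem using hω hmem.1 hmem.2
  · exact mem_ae_iff_prob_eq_one hA |>.2 h1

/-- The set reached from z is the required sink; it stays in the support because the support is
closed for the walk. -/
theorem ae_exists_isSink_of_mem_suppAt (hQ : IsErgodicInvariant Q) (hac : Q ≪ envLaw ν) {Φ : ℝ}
    (hΦ : 0 < Φ) (h : IsReflectedSupportBound (envLaw ν) Φ) :
    ∀ᵐ ω ∂envLaw ν, ∀ z ∈ suppAt (envLaw ν) Q ω,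
      ∃ S, IsSink ω S ∧ S ⊆ suppAt (envLaw ν) Q ω ∧ z ∈ S := by
  have := hQ.prob
  filter_upwards [ae_walkClosed_suppAt hQ hac,
    ae_forall_from (ae_densitySupport_imp hac (ae_mem_originInSink hQ hac hΦ h))] with ω h1 h2 z hz
  exact ⟨_, isSink_reach (h2 z hz), fun y hy => h1.mem_of_reach hz hy,
    Relation.ReflTransGen.refl⟩

theorem ae_nonempty_suppAt (hQ : IsErgodicInvariant Q) (hac : Q ≪ envLaw ν) :
    ∀ᵐ ω ∂envLaw ν, (suppAt (envLaw ν) Q ω).Nonempty := by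
  have := hQ.prob
  exact ae_exists_from (measurableSet_densitySupport _ Q) (measure_densitySupport_ne_zero hac)

end Law

end BalancedRWRE

theorem mainTheorem8 {d : ℕ} (ν : Measure (BalancedRWRE.LocalLaw d)) [IsProbabilityMeasure ν]
    (P : Measure (BalancedRWRE.Env d)) (hP : P = BalancedRWRE.envLaw ν)
    (hbal : ∀ᵐ ω ∂P, BalancedRWRE.Balanced ω)
    (hgen : ∀ᵐ ω ∂P, BalancedRWRE.GenuinelyDDimensional ω) :
    (∃ κ : ℝ, 0 < κ ∧ ∀ Q : Measure (BalancedRWRE.Env d),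
      BalancedRWRE.IsErgodicInvariant Q → Q ≪ P →
        ∀ᵐ ω ∂P, ∃ A : Set (BalancedRWRE.Site d), A ⊆ BalancedRWRE.suppAt P Q ω ∧
          BalancedRWRE.IsSink ω A ∧ κ ≤ BalancedRWRE.upperDensity A) ∧
    (∃ Φ : ℝ, 0 < Φ ∧ BalancedRWRE.IsReflectedSupportBound P Φ) ∧
    (∀ Φ : ℝ, 0 < Φ → BalancedRWRE.IsReflectedSupportBound P Φ →
      ∀ᵐ ω ∂P, ∀ S : Set (BalancedRWRE.Site d), BalancedRWRE.IsSink ω S →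
        Φ / 2 ^ d ≤ BalancedRWRE.lowerDensity S) ∧
    (∀ Q : Measure (BalancedRWRE.Env d), BalancedRWRE.IsErgodicInvariant Q → Q ≪ P →
      ∀ᵐ ω ∂P,
        {S : Set (BalancedRWRE.Site d) |
          BalancedRWRE.IsSink ω S ∧ S ⊆ BalancedRWRE.suppAt P Q ω}.Finite ∧
        (∀ x ∈ BalancedRWRE.suppAt P Q ω, ∃ S : Set (BalancedRWRE.Site d),
          BalancedRWRE.IsSink ω S ∧ x ∈ S) ∧
        BalancedRWRE.suppAt P Q ω =
          ⋃₀ {S : Set (BalancedRWRE.Site d) |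
            BalancedRWRE.IsSink ω S ∧ S ⊆ BalancedRWRE.suppAt P Q ω}) := by
  subst hP
  obtain ⟨Φ, hΦ, h⟩ := BalancedRWRE.exists_supportBound ν hbal hgen
  have hpos : (0 : ℝ) < Φ / 2 ^ d := by positivity
  -- The constant κ comes from one support constant of P and hence does not depend on Q.
  refine ⟨⟨Φ / 2 ^ d, hpos, fun Q hQ hac => ?_⟩, ⟨Φ, hΦ, h⟩,
    fun Φ _ h => h.ae_le_lowerDensity, fun Q hQ hac => ?_⟩
  · filter_upwards [BalancedRWRE.ae_exists_isSink_of_mem_suppAt hQ hac hΦ h,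
      BalancedRWRE.ae_nonempty_suppAt hQ hac, h.ae_le_lowerDensity] with ω h1 ⟨z, hz⟩ h2
    obtain ⟨S, hS, hsub, -⟩ := h1 z hz
    exact ⟨S, hsub, hS, (h2 S hS).trans (BalancedRWRE.lowerDensity_le_upperDensity S)⟩
  · filter_upwards [BalancedRWRE.ae_exists_isSink_of_mem_suppAt hQ hac hΦ h,
      h.ae_le_lowerDensity] with ω h1 h2
    refine ⟨(BalancedRWRE.finite_setOf_isSink hpos h2).subset fun S hS => hS.1, fun x hx => ?_, ?_⟩
    · obtain ⟨S, hS, -, hxS⟩ := h1 x hx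
      exact ⟨S, hS, hxS⟩
    · refine Set.Subset.antisymm (fun x hx => ?_) (Set.sUnion_subset fun S hS => hS.2)
      obtain ⟨S, hS, hsub, hxS⟩ := h1 x hx
      exact ⟨S, ⟨hS, hsub⟩, hxS⟩
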